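/- **Setting.** Let $A\in\mathbb R^{n\times n}$, $B\in\mathbb R^{n\times m}$, and let $F\in\mathbb R^{r\times n}$ be nonzero with $r=O(n)$, say $r\le\rho n$ for a fixed $\rho$. Consider $\dot x(t)=Ax(t)+Bu(t)$, an output $y(t)=Cx(t)$ and the functional privacy $z(t)=Fx(t)$. The functional privacy is *inferable* if for every initial state $x(0)$ and every input $u$ there is a finite time $t_f$ such that $Fx(0)$ is uniquely determined by $u$ and $y(t)$, $0\le t\le t_f$; otherwise it is (vector-wise) *protected*. *Blocking* $S\subseteq[n]=\{1,\dots,n\}$ replaces $C$ by the matrix $C^{[n]\setminus S}$ obtained by setting the columns indexed by $S$ to zero. **Problem 1.** Find a set $S\subseteq[n]$ of minimum cardinality such that for every output matrix $C$ the privacy $z$ is protected when $C$ is replaced by $C^{[n]\setminus S}$. Equivalent form: find $S$ of minimum cardinality such that $(A,I^{[n]\setminus S},F)$ is not functionally observable, where $(A,C,F)$ is *functionally observable* if any two initial states $x_1,x_2$ whose outputs under a common input coincide for all $t\ge0$ satisfy $Fx_1=Fx_2$. **Assumptions.** The distinct eigenvalues $\lambda_1,\dots,\lambda_q\in\mathbb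 C$ of $A$ and, for each $i$, a matrix $X_i\in\mathbb C^{n\times k_i}$ whose columns form a basis of the eigenspace of $\lambda_i$ are available (obtaining them is charged $O(n^3)$ operations); $A$ is diagonalizable over $\mathbb C$; and $k_i\le k_c$ for all $i\in[q]$. For a matrix $M$ and an index set $W$, $M_W$ denotes the submatrix of rows indexed by $W$. **Algorithm 1** (input $X_i$). For each set $W\subseteq[n]$ of $k_i-1$ linearly independent rows of $X_i$, put $W'=W\cup\{j:\operatorname{rank}[X_i]_{W\cup\{j\}}=k_i-1\}$ and $S=[n]\setminus W'$. Return the collection $\Omega_i$ of all these sets $S$. **Algorithm 2** (input $A,F$). Obtain $X_1,\dots,X_q$. For each $i\in[q]$: compute $\Omega_i$ with Algorithm 1; for each $S\in\Omega_i$ check whether $\operatorname{rank}\begin{bmatrix}A-\lambda_iI_n\\ I^{[n]\setminus S}\\ F\end{bmatrix}=n$, the check being carried out as $\operatorname{rank}\begin{bmatrix}[X_i]_{[n]\setminus S}\\ FX_i\end{bmatrix}=k_i$, and replace $S$ by $[n]$ if it fails; let $S_i^*$ be a smallest resulting set. Return a smallest one among $S_1^*,\dots,S_q^*$. Ranks are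 computed by Gaussian elimination. **Theorem.** Algorithm 2 returns an optimal solution to Problem 1 (in both forms). For each $i$, $\Omega_i$ is exactly the collection of the inclusion-minimal sets $S\subseteq[n]$ with $\operatorname{rank}\begin{bmatrix}A-\lambda_iI_n\\ I^{[n]\setminus S}\end{bmatrix}=n-1$, and the check accepts exactly those $S\in\Omega_i$ for which $\operatorname{rank}\begin{bmatrix}A-\lambda_iI_n\\ I^{[n]\setminus S}\\ F\end{bmatrix}=n$. The running time, counted in elementary steps (exact arithmetic operations and zero tests on scalars, operations on natural numbers and list cells, each of unit cost), is $O(n^{k_c+2}k_c^3)$, where the implied constant depends only on $\rho$ and on the constant in the $O(n^3)$ charge for the eigendata. -/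

import Mathlib

open MeasureTheory

namespace FunctionalPrivacy

/-! ## The network, trajectories, inferability, and the blocking problem -/

section Network

variable {n m p r : ℕ}

/-- `ξ` is the (Carathéodory) solution on `[0, ∞)` of `ẋ(t) = A x(t) + B u(t)`, `x(0) = x₀`, for a
locally integrable input `u`: a continuous solution of the integrated equation. -/
structure IsTrajectory (A : Matrix (Fin n) (Fin n) ℝ) (B : Matrix (Fin n) (Fin m) ℝ)
    (u : ℝ → Fin m → ℝ) (x₀ : Fin n → ℝ) (ξ : ℝ → Fin n → ℝ) : Prop where
  input_integrable : ∀ t : ℝ, 0 ≤ t → IntervalIntegrable u volume 0 t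
  continuousOn : ContinuousOn ξ (Set.Ici 0)
  eq_integral : ∀ t : ℝ, 0 ≤ t →
    ξ t = x₀ + ∫ s in (0 : ℝ)..t, (A.mulVec (ξ s) + B.mulVec (u s))

/-- `z(t) = F x(t)` is inferable from the output `y(t) = C x(t)`: for every initial state and every
input there is a finite time `tf` such that the input together with the output on `[0, tf]`
determines `F x(0)` uniquely. -/
def Inferable (A : Matrix (Fin n) (Fin n) ℝ) (B : Matrix (Fin n) (Fin m) ℝ)
    (C : Matrix (Fin p) (Fin n) ℝ) (F : Matrix (Fin r) (Fin n) ℝ) : Prop :=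
  ∀ (x : Fin n → ℝ) (u : ℝ → Fin m → ℝ) (ξ : ℝ → Fin n → ℝ), IsTrajectory A B u x ξ →
    ∃ tf : ℝ, 0 ≤ tf ∧
      ∀ (x' : Fin n → ℝ) (ξ' : ℝ → Fin n → ℝ), IsTrajectory A B u x' ξ' →
        (∀ t ∈ Set.Icc 0 tf, C.mulVec (ξ' t) = C.mulVec (ξ t)) → F.mulVec x' = F.mulVec x

/-- The functional privacy `z(t) = F x(t)` is (vector-wisely) protected. -/
def Protected (A : Matrix (Fin n) (Fin n) ℝ) (B : Matrix (Fin n) (Fin m) ℝ)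
    (C : Matrix (Fin p) (Fin n) ℝ) (F : Matrix (Fin r) (Fin n) ℝ) : Prop :=
  ¬ Inferable A B C F

/-- Functional observability: equal inputs and equal outputs on `[0, ∞)` force equal `F x(0)`. -/
def FunctionallyObservable (A : Matrix (Fin n) (Fin n) ℝ) (B : Matrix (Fin n) (Fin m) ℝ)
    (C : Matrix (Fin p) (Fin n) ℝ) (F : Matrix (Fin r) (Fin n) ℝ) : Prop :=
  ∀ (x₁ x₂ : Fin n → ℝ) (u : ℝ → Fin m → ℝ) (ξ₁ ξ₂ : ℝ → Fin n → ℝ),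
    IsTrajectory A B u x₁ ξ₁ → IsTrajectory A B u x₂ ξ₂ →
      (∀ t : ℝ, 0 ≤ t → C.mulVec (ξ₁ t) = C.mulVec (ξ₂ t)) → F.mulVec x₁ = F.mulVec x₂

/-- Blocking the state variables in `S`: the columns of `C` indexed by `S` are set to zero. -/
def blockColumns {ι R : Type*} [Zero R] (C : Matrix ι (Fin n) R) (S : Finset (Fin n)) :
    Matrix ι (Fin n) R :=
  Matrix.of fun i j => if j ∈ S then 0 else C i j

/-- Blocking `S` protects `z(t) = F x(t)` whatever the output matrix is. -/
def BlocksEveryOutput (A : Matrix (Fin n) (Fin n) ℝ) (B : Matrix (Fin n) (Fin m) ℝ)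
    (F : Matrix (Fin r) (Fin n) ℝ) (S : Finset (Fin n)) : Prop :=
  ∀ (p : ℕ) (C : Matrix (Fin p) (Fin n) ℝ), Protected A B (blockColumns C S) F

/-- With dedicated sensors at exactly the states outside `S`, the system is not functionally
observable. -/
def BlocksDedicated (A : Matrix (Fin n) (Fin n) ℝ) (B : Matrix (Fin n) (Fin m) ℝ)
    (F : Matrix (Fin r) (Fin n) ℝ) (S : Finset (Fin n)) : Prop :=
  ¬ FunctionallyObservable A B (blockColumns (1 : Matrix (Fin n) (Fin n) ℝ) S) F

/-- `S` is feasible and has minimum cardinality among all feasible sets. -/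
def IsMinimumSet (Feasible : Finset (Fin n) → Prop) (S : Finset (Fin n)) : Prop :=
  Feasible S ∧ ∀ T : Finset (Fin n), Feasible T → S.card ≤ T.card

end Network

/-! ## Spectral data -/

section Spectral

variable {n r : ℕ}

/-- The real matrix `M`, seen as a complex matrix. -/
def complexify {m' n' : Type*} (M : Matrix m' n' ℝ) : Matrix m' n' ℂ :=
  M.map Complex.ofReal

/-- `A` is diagonalizable over `ℂ`. -/
def IsDiagonalizable (A : Matrix (Fin n) (Fin n) ℝ) : Prop :=
  ∃ (P : Matrix (Fin n) (Fin n) ℂ) (d : Fin n → ℂ),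
    IsUnit P.det ∧ complexify A = P * Matrix.diagonal d * P⁻¹

/-- The eigendata of `A`: its distinct eigenvalues `λ₁, …, λ_q`, their geometric multiplicities
`k₁, …, k_q`, and for each of them an `n × kᵢ` matrix `Xᵢ` whose columns form a basis of the
eigenspace. -/
structure EigenData (A : Matrix (Fin n) (Fin n) ℝ) where
  q : ℕ
  eigenvalue : Fin q → ℂ
  eigenvalue_injective : Function.Injective eigenvalue
  eigenvalue_complete : ∀ μ : ℂ,
    Module.End.HasEigenvalue (Matrix.toLin' (complexify A)) μ ↔ ∃ i, eigenvalue i = μ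
  mult : Fin q → ℕ
  basis : (i : Fin q) → Matrix (Fin n) (Fin (mult i)) ℂ
  basis_linearIndependent : ∀ i, LinearIndependent ℂ (basis i).col
  basis_span : ∀ i, Submodule.span ℂ (Set.range (basis i).col) =
    Module.End.eigenspace (Matrix.toLin' (complexify A)) (eigenvalue i)

/-- The eigenbases of `A`, as a list of matrices with `n` rows. -/
def EigenData.basisList {A : Matrix (Fin n) (Fin n) ℝ} (E : EigenData A) :
    List ((k : ℕ) × Matrix (Fin n) (Fin k) ℂ) :=
  List.ofFn fun i => ⟨E.mult i, E.basis i⟩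

/-- The matrix `col{A - λ I, I^{[n] \ S}}`. -/
noncomputable def sensorPencil (A : Matrix (Fin n) (Fin n) ℝ) (μ : ℂ) (S : Finset (Fin n)) :
    Matrix (Fin n ⊕ Fin n) (Fin n) ℂ :=
  Matrix.fromRows (complexify A - μ • (1 : Matrix (Fin n) (Fin n) ℂ))
    (blockColumns (1 : Matrix (Fin n) (Fin n) ℂ) S)

/-- The matrix `col{A - λ I, I^{[n] \ S}, F}`. -/
noncomputable def sensorPencilWith (A : Matrix (Fin n) (Fin n) ℝ) (F : Matrix (Fin r) (Fin n) ℝ)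
    (μ : ℂ) (S : Finset (Fin n)) : Matrix ((Fin n ⊕ Fin n) ⊕ Fin r) (Fin n) ℂ :=
  Matrix.fromRows (sensorPencil A μ S) (complexify F)

end Spectral

/-! ## Step-counted computations

The cost model is the usual unit-cost one with exact arithmetic. One step performs a bounded number
of the following, reading the operands included: an arithmetic operation or a zero test on scalars,
an operation on natural numbers, the construction or inspection of one list cell. A matrix is a
random-access array. Every algorithm below is written, entry by entry and cell by cell, by structural
recursion, for scalars in an arbitrary field with decidable equality. -/

/-- A value together with the number of steps spent to compute it. -/
structure Timed (α : Type*) where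
  value : α
  time : ℕ

instance : Monad Timed where
  pure a := ⟨a, 0⟩
  bind x f := ⟨(f x.value).value, x.time + (f x.value).time⟩

/-- One elementary step, producing the value `a`. -/
def step {α : Type} (a : α) : Timed α := ⟨a, 1⟩

/-- Spend `c` steps. -/
def charge (c : ℕ) : Timed Unit := ⟨(), c⟩

section Lists

variable {α : Type}

/-- Concatenation of lists. -/
def appendLists : List α → List α → Timed (List α)
  | [], l₂ => step l₂
  | a :: l₁, l₂ => do
      let l ← appendLists l₁ l₂
      step (a :: l)

/-- Put `a` in front of every list. -/
def consAll (a : α) : List (List α) → Timed (List (List α))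
  | [] => step []
  | l :: ls => do
      let ls' ← consAll a ls
      step ((a :: l) :: ls')

/-- All sublists of a given length, that is, all subsets of a given size. -/
def subsetsOfSize : ℕ → List α → Timed (List (List α))
  | 0, _ => step [[]]
  | _ + 1, [] => step []
  | m + 1, a :: l => do
      let s₁ ← subsetsOfSize m l
      let s₂ ← consAll a s₁
      let s₃ ← subsetsOfSize (m + 1) l
      appendLists s₂ s₃

/-- The length of a list. -/
def countList : List α → Timed ℕ
  | [] => step 0
  | _ :: l => do
      let c ← countList l
      step (c + 1)

/-- The shorter of two lists. -/
def shorter (S T : List α) : Timed (List α) := do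
  let a ← countList S
  let b ← countList T
  let t ← step (decide (a ≤ b))
  if t then step S else step T

/-- Write down the list `0, 1, …, n - 1` of all indices. -/
def allIndices (n : ℕ) : Timed (List (Fin n)) := do
  charge (n + 1)
  pure (List.finRange n)

end Lists

section Scalars

variable {K : Type} [Field K] [DecidableEq K]

/-- Read an array of `k` entries into a list. -/
def readRow : (k : ℕ) → (Fin k → K) → Timed (List K)
  | 0, _ => step []
  | k + 1, v => do
      let x ← step (v 0)
      let xs ← readRow k (fun j => v j.succ)
      step (x :: xs)

/-- Read the rows of `X` with the given indices. -/
def readRows {n k : ℕ} (X : Matrix (Fin n) (Fin k) K) : List (Fin n) → Timed (List (List K))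
  | [] => step []
  | j :: js => do
      let row ← readRow k (X j)
      let rows ← readRows X js
      step (row :: rows)

/-- `x - c y` for vectors `x`, `y`. -/
def subMul (c : K) : List K → List K → Timed (List K)
  | x :: xs, y :: ys => do
      let z ← step (c * y)
      let d ← step (x - z)
      let ds ← subMul c xs ys
      step (d :: ds)
  | _, _ => step []

/-- Find the first row with a nonzero leading entry, if there is one; the other rows are returned
too. -/
def extractPivot : List (List K) → Timed (Option (List K) × List (List K))
  | [] => step (none, [])
  | row :: rows => do
      let z ← step (decide (row.headD 0 = 0))
      if z then
        let e ← extractPivot rows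
        step (e.1, row :: e.2)
      else step (some row, rows)

/-- Clear the leading entry of every row with the pivot row, and drop it. -/
def eliminate (pivot : List K) : List (List K) → Timed (List (List K))
  | [] => step []
  | row :: rows => do
      let c ← step (row.headD 0 / pivot.headD 0)
      let row' ← subMul c row.tail pivot.tail
      let rows' ← eliminate pivot rows
      step (row' :: rows')

/-- Drop the leading entry of every row. -/
def dropColumn : List (List K) → Timed (List (List K))
  | [] => step []
  | row :: rows => do
      let rows' ← dropColumn rows
      step (row.tail :: rows')

/-- The rank of a matrix with `k` columns, given by its rows, by Gaussian elimination. -/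
def rankOf : (k : ℕ) → List (List K) → Timed ℕ
  | 0, _ => step 0
  | k + 1, rows => do
      let e ← extractPivot rows
      match e.1 with
      | none => do
          let rows' ← dropColumn e.2
          rankOf k rows'
      | some pivot => do
          let rows' ← eliminate pivot e.2
          let ρ ← rankOf k rows'
          step (ρ + 1)

/-! ## The enumeration of minimal sets -/

/-- Given the rows `X_W` of the eigenbasis `X`, with `rank X_W = k - 1`, distribute the listed
indices `j` between `W' = {j : rank X_{W ∪ {j}} = k - 1}` (which contains `W`) and its
complement. -/
def splitByRank {n k : ℕ} (X : Matrix (Fin n) (Fin k) K) (rowsW : List (List K)) :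
    List (Fin n) → Timed (List (Fin n) × List (Fin n))
  | [] => step ([], [])
  | j :: js => do
      let row ← readRow k (X j)
      let ρ ← rankOf k (row :: rowsW)
      let t ← step (decide (ρ + 1 = k))
      let e ← splitByRank X rowsW js
      if t then step (j :: e.1, e.2) else step (e.1, j :: e.2)

/-- Go through the candidate sets `W`, and for those that index `k - 1` linearly independent rows of
`X`, return `(W', S)` with `S = [n] \ W'`. -/
def closeCandidates {n k : ℕ} (X : Matrix (Fin n) (Fin k) K) (idx : List (Fin n)) :
    List (List (Fin n)) → Timed (List (List (Fin n) × List (Fin n)))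
  | [] => step []
  | W :: Ws => do
      let rows ← readRows X W
      let ρ ← rankOf k rows
      let t ← step (decide (ρ + 1 = k))
      let rest ← closeCandidates X idx Ws
      if t then
        let e ← splitByRank X rows idx
        step (e :: rest)
      else step rest

/-- The enumeration algorithm: for an eigenbasis `X`, list the pairs `(W', S)`, `S = [n] \ W'`, that
arise from all sets `W` indexing `k - 1` linearly independent rows of `X`. -/
def enumerateMinimalSets {n k : ℕ} (X : Matrix (Fin n) (Fin k) K) :
    Timed (List (List (Fin n) × List (Fin n))) := do
  let idx ← allIndices n
  let cands ← subsetsOfSize (k - 1) idx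
  closeCandidates X idx cands

/-! ## The algorithm for the minimum blocking set -/

/-- The row vector `f X`, restricted to the given indices of summation. -/
def rowMul {n k : ℕ} (f : Fin n → K) (X : Matrix (Fin n) (Fin k) K) :
    List (Fin n) → Timed (List K)
  | [] => readRow k (fun _ => 0)
  | j :: js => do
      let acc ← rowMul f X js
      let c ← step (-(f j))
      let row ← readRow k (X j)
      subMul c acc row

/-- The listed rows of the matrix product `F X`. -/
def matMulRows {n k r : ℕ} (F : Matrix (Fin r) (Fin n) K) (X : Matrix (Fin n) (Fin k) K)
    (idx : List (Fin n)) : List (Fin r) → Timed (List (List K))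
  | [] => step []
  | i :: is => do
      let row ← rowMul (F i) X idx
      let rows ← matMulRows F X idx is
      step (row :: rows)

/-- The rows of `F X`. -/
def matMul {n k r : ℕ} (F : Matrix (Fin r) (Fin n) K) (X : Matrix (Fin n) (Fin k) K) :
    Timed (List (List K)) := do
  let idx ← allIndices n
  let jdx ← allIndices r
  matMulRows F X idx jdx

/-- The test of `rank col{A - λ I, I^{[n] \ S}, F} = n`, carried out on the eigenbasis `X` as the
test of `rank col{X_{W'}, F X} = k`, where `W' = [n] \ S`. -/
def fullRankCheck {n k : ℕ} (X : Matrix (Fin n) (Fin k) K) (FX : List (List K))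
    (W' : List (Fin n)) : Timed Bool := do
  let rows ← readRows X W'
  let stacked ← appendLists rows FX
  let ρ ← rankOf k stacked
  step (decide (ρ = k))

/-- Replace every enumerated set that fails the test by `[n]`, and return a smallest set. -/
def smallestPassing {n k : ℕ} (X : Matrix (Fin n) (Fin k) K) (FX : List (List K))
    (idx : List (Fin n)) : List (List (Fin n) × List (Fin n)) → Timed (List (Fin n))
  | [] => step idx
  | e :: es => do
      let best ← smallestPassing X FX idx es
      let ok ← fullRankCheck X FX e.1
      let cand ← step (if ok then e.2 else idx)
      shorter cand best

/-- The loop over the eigenvalues, returning a smallest one of the sets found for each of them. -/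
def smallestOverEigenvalues {n r : ℕ} (F : Matrix (Fin r) (Fin n) K) (idx : List (Fin n)) :
    List ((k : ℕ) × Matrix (Fin n) (Fin k) K) → Timed (List (Fin n))
  | [] => step idx
  | X :: Xs => do
      let best ← smallestOverEigenvalues F idx Xs
      let omega ← enumerateMinimalSets X.2
      let FX ← matMul F X.2
      let S ← smallestPassing X.2 FX idx omega
      shorter S best

/-- The algorithm for the minimum blocking set. The eigenbases are available to it; obtaining them is
charged with `c₀ n ^ 3` steps. -/
def minimumBlockingSet {n r : ℕ} (c₀ : ℕ) (F : Matrix (Fin r) (Fin n) K)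
    (bases : List ((k : ℕ) × Matrix (Fin n) (Fin k) K)) : Timed (List (Fin n)) := do
  charge (c₀ * n ^ 3)
  let idx ← allIndices n
  smallestOverEigenvalues F idx bases

end Scalars

end FunctionalPrivacy

/-!
Blocking `S` protects `F x` exactly when `S` hides a mode seen by `F`: some complex eigenvector `v` of
`A` is supported on `S` and `F v ≠ 0` (`HidesMode`).

* If there is such a mode, the real part of `e^{μ t} v` (or of `-i e^{μ t} v`) is a trajectory with zero
  input that no sensor outside `S` can tell from the zero trajectory, although `F` tells their initial
  states apart.
* Conversely, let two trajectories with a common input agree outside `S` on `[0, 1]`. Their difference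
  `η` solves `η' = A η`, and repeated differentiation of the vanishing coordinates shows that `A ^ k η(0)`
  is supported on `S` for every `k`. Such initial states form an `A`-invariant subspace; as `A` is
  diagonalizable it is spanned by eigenvectors, and `F` has to see one of them if it sees `η(0)`
  (`hidesMode_of_trajectories`).

Hence both forms of the problem ask for a smallest `S` that hides a mode. For an eigenbasis `X`, the
eigenvectors supported on `S` are the `X c` with `c` orthogonal to the rows of `X` outside `S`
(`hiddenCoeffs X S`), so `rank col{A - λ I, I^{[n] \ S}} = n - 1` says that the rows outside `S` span a
hyperplane, and the minimal such `S` are the complements of the sets of all rows in a hyperplane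
spanned by `k - 1` independent rows. These are the sets that the algorithm enumerates
(`enumerated_iff_minimal`). A minimal `S` that hides a mode seen by `F` is one of them and passes the rank
test, since eliminating one coordinate against another hidden vector would shrink the support
(`exists_minimal_hidden`); so the shortest set that passes the test is optimal
(`EigenData.isMinimumSet_hidesMode`).

For the running time, each of the at most `n ^ (k - 1)` candidates costs `n + 1` eliminations on at
most `k` rows and one on at most `n + r` rows with `k` entries, that is `O(n k ^ 3)`; each eigenvalue costs
`O(n ^ (k + 1) k ^ 3)` including the product `F X`, and there are at most `n` eigenvalues.
-/

namespace FunctionalPrivacy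

/-! ### Values of the list programs -/

@[simp] lemma value_bind {α β : Type} (x : Timed α) (f : α → Timed β) :
    (x >>= f).value = (f x.value).value := rfl

@[simp] lemma value_step {α : Type} (a : α) : (step a).value = a := rfl

@[simp] lemma value_ite {α : Type} (b : Prop) [Decidable b] (x y : Timed α) :
    (if b then x else y).value = if b then x.value else y.value := by
  split <;> rfl

section Lists

variable {α : Type}

@[simp] lemma appendLists_value (l₁ l₂ : List α) : (appendLists l₁ l₂).value = l₁ ++ l₂ := by
  induction l₁ with
  | nil => rfl
  | cons a l ih => simp [appendLists, ih]

@[simp] lemma consAll_value (a : α) (ls : List (List α)) :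
    (consAll a ls).value = ls.map (a :: ·) := by
  induction ls with
  | nil => rfl
  | cons l ls ih => simp [consAll, ih]

@[simp] lemma countList_value (l : List α) : (countList l).value = l.length := by
  induction l with
  | nil => rfl
  | cons a l ih => simp [countList, ih]

@[simp] lemma shorter_value (S T : List α) :
    (shorter S T).value = if S.length ≤ T.length then S else T := by
  simp [shorter]

@[simp] lemma allIndices_value (n : ℕ) : (allIndices n).value = List.finRange n := rfl

lemma mem_subsetsOfSize_value (m : ℕ) (L l : List α) :
    l ∈ (subsetsOfSize m L).value ↔ l.Sublist L ∧ l.length = m := by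
  induction L generalizing m l with
  | nil =>
    cases m with
    | zero => simp [subsetsOfSize]
    | succ m =>
      simp only [subsetsOfSize, value_step, List.not_mem_nil, List.sublist_nil, false_iff]
      rintro ⟨rfl, h⟩
      simp at h
  | cons a L ih =>
    cases m with
    | zero =>
      simp only [subsetsOfSize, value_step, List.mem_singleton]
      constructor
      · rintro rfl
        simp
      · rintro ⟨-, h⟩
        exact List.length_eq_zero_iff.mp h
    | succ m =>
      simp only [subsetsOfSize, value_bind, appendLists_value, consAll_value, List.mem_append,
        List.mem_map, ih]
      constructor
      · rintro (⟨l', ⟨h, rfl⟩, rfl⟩ | ⟨h, h'⟩)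
        · exact ⟨h.cons_cons a, rfl⟩
        · exact ⟨h.cons a, h'⟩
      · rintro ⟨h, h'⟩
        cases h with
        | cons _ h => exact Or.inr ⟨h, h'⟩
        | cons_cons _ h => exact Or.inl ⟨_, ⟨h, by simpa using h'⟩, rfl⟩

lemma length_subsetsOfSize_value (m : ℕ) (L : List α) :
    (subsetsOfSize m L).value.length = L.length.choose m := by
  induction L generalizing m with
  | nil => cases m <;> simp [subsetsOfSize]
  | cons a L ih => cases m <;> simp [subsetsOfSize, ih, Nat.choose_succ_succ]

@[simp] lemma readRow_value {k : ℕ} (v : Fin k → α) : (readRow k v).value = List.ofFn v := by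
  induction k with
  | zero => simp [readRow]
  | succ k ih => simp [readRow, ih, List.ofFn_succ]

@[simp] lemma readRows_value {n k : ℕ} (X : Matrix (Fin n) (Fin k) α) (js : List (Fin n)) :
    (readRows X js).value = (js.map X.row).map List.ofFn := by
  induction js with
  | nil => rfl
  | cons j js ih =>
    simp only [readRows, value_bind, value_step, ih, readRow_value, List.map_cons]
    rfl

lemma dropColumn_value {k : ℕ} (vs : List (Fin (k + 1) → α)) :
    (dropColumn (vs.map List.ofFn)).value = (vs.map Fin.tail).map List.ofFn := by
  induction vs with
  | nil => rfl
  | cons v vs ih =>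
    simp only [List.map_cons, dropColumn, value_bind, value_step, ih, List.ofFn_succ, List.tail_cons]
    rfl

end Lists

/-! ### Vectors and Gaussian elimination -/

section Vectors

variable {K : Type} [Field K]

/-- Prepending a zero coordinate. -/
def consZero (K : Type) [Field K] (k : ℕ) : (Fin k → K) →ₗ[K] (Fin (k + 1) → K) where
  toFun v := Fin.cons 0 v
  map_add' v w := by ext i; refine Fin.cases ?_ (fun i => ?_) i <;> simp
  map_smul' c v := by ext i; refine Fin.cases ?_ (fun i => ?_) i <;> simp

lemma consZero_injective (k : ℕ) : Function.Injective (consZero K k) := fun _ _ h =>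
  Fin.cons_right_injective (α := fun _ => K) 0 h

lemma consZero_apply_zero {k : ℕ} (v : Fin k → K) : consZero K k v 0 = 0 := rfl

lemma consZero_tail {k : ℕ} {v : Fin (k + 1) → K} (h : v 0 = 0) :
    consZero K k (Fin.tail v) = v := by
  conv_rhs => rw [← Fin.cons_self_tail v, h]
  rfl

lemma finrank_span_consZero {k : ℕ} (T : Set (Fin k → K)) :
    Module.finrank K (Submodule.span K (consZero K k '' T)) =
      Module.finrank K (Submodule.span K T) := by
  rw [Submodule.span_image]
  exact LinearEquiv.finrank_eq (Submodule.equivMapOfInjective _ (consZero_injective k) _).symm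

lemma finrank_span_insert_consZero {k : ℕ} (T : Set (Fin k → K)) {p : Fin (k + 1) → K}
    (hp : p 0 ≠ 0) :
    Module.finrank K (Submodule.span K (insert p (consZero K k '' T))) =
      Module.finrank K (Submodule.span K T) + 1 := by
  have hpm : p ∉ Submodule.span K (consZero K k '' T) := by
    rw [Submodule.span_image]
    rintro ⟨y, -, rfl⟩
    exact hp rfl
  rw [Submodule.span_insert, sup_comm, Submodule.finrank_sup_span_singleton hpm,
    finrank_span_consZero]

lemma subMul_value (c : K) {k : ℕ} (x y : Fin k → K) :
    (subMul c (List.ofFn x) (List.ofFn y)).value = List.ofFn (x - c • y) := by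
  induction k with
  | zero => simp [subMul]
  | succ k ih =>
    simp only [List.ofFn_succ, subMul, value_bind, value_step, ih]
    rfl

/-- One step of Gaussian elimination with pivot row `p`, on the row `v`. -/
def clearLeading {k : ℕ} (p v : Fin (k + 1) → K) : Fin k → K :=
  Fin.tail v - (v 0 / p 0) • Fin.tail p

lemma eliminate_value {k : ℕ} (p : Fin (k + 1) → K) (vs : List (Fin (k + 1) → K)) :
    (eliminate (List.ofFn p) (vs.map List.ofFn)).value =
      (vs.map (clearLeading p)).map List.ofFn := by
  induction vs with
  | nil => rfl
  | cons v vs ih =>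
    simp only [List.map_cons, eliminate, value_bind, value_step, ih]
    simp only [List.ofFn_succ, List.tail_cons, List.headD_cons, subMul_value]
    rfl

lemma rowMul_value {n k : ℕ} (f : Fin n → K) (X : Matrix (Fin n) (Fin k) K) (js : List (Fin n)) :
    (rowMul f X js).value = List.ofFn (js.map fun j => f j • X j).sum := by
  induction js with
  | nil =>
    simp only [rowMul, readRow_value]
    rfl
  | cons j js ih =>
    simp only [rowMul, value_bind, value_step, ih, readRow_value, subMul_value, List.map_cons,
      List.sum_cons]
    congr 1
    module

lemma matMulRows_value {n k r : ℕ} (F : Matrix (Fin r) (Fin n) K) (X : Matrix (Fin n) (Fin k) K)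
    (is : List (Fin r)) :
    (matMulRows F X (List.finRange n) is).value = (is.map (F * X).row).map List.ofFn := by
  induction is with
  | nil => rfl
  | cons i is ih =>
    simp only [matMulRows, value_bind, value_step, ih, rowMul_value, List.map_cons]
    congr 2
    ext t
    rw [← List.ofFn_eq_map, List.sum_ofFn]
    simp [Matrix.row, Matrix.mul_apply]

lemma matMul_value {n k r : ℕ} (F : Matrix (Fin r) (Fin n) K) (X : Matrix (Fin n) (Fin k) K) :
    (matMul F X).value = ((List.finRange r).map (F * X).row).map List.ofFn := by
  simp [matMul, matMulRows_value]

end Vectors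

section Scalars

variable {K : Type} [Field K] [DecidableEq K]

/-- The two outcomes of the search for a pivot row. -/
lemma extractPivot_value {k : ℕ} (vs : List (Fin (k + 1) → K)) :
    ((extractPivot (vs.map List.ofFn)).value = (none, vs.map List.ofFn) ∧ ∀ v ∈ vs, v 0 = 0) ∨
    ∃ p ws, (extractPivot (vs.map List.ofFn)).value = (some (List.ofFn p), ws.map List.ofFn) ∧
      vs.Perm (p :: ws) ∧ p 0 ≠ 0 := by
  induction vs with
  | nil => left; simp [extractPivot]
  | cons v vs ih =>
    have hv : (List.ofFn v).headD 0 = v 0 := by simp [List.ofFn_succ]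
    by_cases h0 : v 0 = 0
    · rcases ih with ⟨h, h'⟩ | ⟨p, ws, h, hp, hp0⟩
      · left
        simp only [List.map_cons, extractPivot, value_bind, value_step, hv, h0, decide_true, if_true,
          h]
        simpa [h0] using h'
      · right
        refine ⟨p, v :: ws, ?_, (hp.cons v).trans (List.Perm.swap _ _ _), hp0⟩
        simp only [List.map_cons, extractPivot, value_bind, value_step, hv, h0, decide_true, if_true,
          h]
    · right
      refine ⟨v, vs, ?_, List.Perm.refl _, h0⟩
      simp [List.map_cons, extractPivot, h0]

/-- Gaussian elimination computes the dimension of the row space. Here, as throughout, the rows handed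
to the programs are the lists `List.ofFn v` of vectors `v : Fin k → K`, so that all have length `k`. -/
lemma rankOf_value {k : ℕ} (vs : List (Fin k → K)) :
    (rankOf k (vs.map List.ofFn)).value = Module.finrank K (Submodule.span K {v | v ∈ vs}) := by
  induction k with
  | zero =>
    simp only [rankOf, value_step]
    exact (Module.finrank_zero_of_subsingleton).symm
  | succ k ih =>
    rcases extractPivot_value vs with ⟨h, h0⟩ | ⟨p, ws, h, hperm, hp⟩
    · simp only [rankOf, value_bind, h, dropColumn_value, ih]
      have himage : consZero K k '' {v | v ∈ vs.map Fin.tail} = {v | v ∈ vs} := by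
        ext v
        constructor
        · rintro ⟨_, hw, rfl⟩
          obtain ⟨w, hw', rfl⟩ := List.mem_map.mp hw
          rwa [consZero_tail (h0 w hw')]
        · exact fun hv => ⟨_, List.mem_map_of_mem hv, consZero_tail (h0 v hv)⟩
      rw [← finrank_span_consZero, himage]
    · simp only [rankOf, value_bind, value_step, h, eliminate_value, ih]
      rw [← finrank_span_insert_consZero _ hp]
      have key : ∀ v : Fin (k + 1) → K,
          consZero K k (clearLeading p v) = v - (v 0 / p 0) • p := by
        intro v
        ext i
        refine Fin.cases ?_ (fun i => ?_) i
        · simp [consZero_apply_zero, hp]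
        · rfl
      have hset : {v | v ∈ vs} = {v | v ∈ p :: ws} := by
        ext v
        exact hperm.mem_iff
      suffices hspan : Submodule.span K
          (insert p (consZero K k '' {v | v ∈ ws.map (clearLeading p)})) =
          Submodule.span K {v | v ∈ vs} by rw [hspan]
      rw [hset]
      apply le_antisymm
      · rw [Submodule.span_le, Set.insert_subset_iff]
        have hpm : p ∈ Submodule.span K {v | v ∈ p :: ws} := Submodule.subset_span (by simp)
        refine ⟨hpm, ?_⟩
        rintro _ ⟨_, hv, rfl⟩
        obtain ⟨v, hv', rfl⟩ := List.mem_map.mp hv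
        rw [key]
        exact Submodule.sub_mem _ (Submodule.subset_span (by simp [hv'])) (Submodule.smul_mem _ _ hpm)
      · rw [Submodule.span_le]
        intro v hv
        rcases List.mem_cons.mp hv with rfl | hv
        · exact Submodule.subset_span (by simp)
        · have : v = consZero K k (clearLeading p v) + (v 0 / p 0) • p := by rw [key]; abel
          rw [this]
          exact Submodule.add_mem _ (Submodule.subset_span (Or.inr ⟨_, List.mem_map_of_mem hv, rfl⟩))
            (Submodule.smul_mem _ _ (Submodule.subset_span (Or.inl rfl)))

end Scalars

/-! ### Hidden vectors of an eigenbasis -/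

section Hidden

variable {K : Type} [Field K] {n k : ℕ}

/-- The vectors orthogonal to all elements of `s`, for the standard bilinear form. -/
def annihilator (s : Set (Fin k → K)) : Submodule K (Fin k → K) where
  carrier := {c | ∀ v ∈ s, v ⬝ᵥ c = 0}
  add_mem' ha hb v hv := by rw [dotProduct_add, ha v hv, hb v hv, add_zero]
  zero_mem' v _ := dotProduct_zero v
  smul_mem' a c hc v hv := by rw [dotProduct_smul, hc v hv, smul_zero]

lemma finrank_annihilator_add {s : Set (Fin k → K)} (hs : s.Finite) :
    Module.finrank K (annihilator s) + Module.finrank K (Submodule.span K s) = k := by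
  have := hs.to_subtype
  let M : Matrix s (Fin k) K := Matrix.of fun v => v.1
  have hrow : Set.range M.row = s := Subtype.range_coe
  have hker : LinearMap.ker M.mulVecLin = annihilator s := by
    ext c
    rw [LinearMap.mem_ker, Matrix.mulVecLin_apply, funext_iff]
    exact ⟨fun h v hv => h ⟨v, hv⟩, fun h v => h v.1 v.2⟩
  have h := LinearMap.finrank_range_add_finrank_ker M.mulVecLin
  have hrank := Matrix.rank_eq_finrank_span_row M
  rw [Matrix.rank, hrow] at hrank
  rw [hker, hrank, Module.finrank_fin_fun] at h
  omega

lemma finrank_span_eq_iff {s : Set (Fin k → K)} (hs : s.Finite) :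
    Module.finrank K (Submodule.span K s) = k ↔ ∀ c, (∀ v ∈ s, v ⬝ᵥ c = 0) → c = 0 := by
  have h := finrank_annihilator_add hs
  have h' : Module.finrank K (annihilator s) = 0 ↔ annihilator s = ⊥ := Submodule.finrank_eq_zero
  rw [Submodule.eq_bot_iff] at h'
  have h'' : (∀ c, (∀ v ∈ s, v ⬝ᵥ c = 0) → c = 0) ↔ ∀ c ∈ annihilator s, c = 0 := Iff.rfl
  rw [h'', ← h']
  omega

/-- The coefficient vectors `c` for which the combination `X c` of the columns of `X` is supported
on `S`: the vectors that are invisible to sensors outside `S`. -/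
def hiddenCoeffs (X : Matrix (Fin n) (Fin k) K) (S : Finset (Fin n)) :
    Submodule K (Fin k → K) :=
  annihilator (X.row '' {j | j ∉ S})

lemma mem_hiddenCoeffs {X : Matrix (Fin n) (Fin k) K} {S : Finset (Fin n)} {c : Fin k → K} :
    c ∈ hiddenCoeffs X S ↔ ∀ j ∉ S, X.mulVec c j = 0 :=
  ⟨fun h j hj => h _ ⟨j, hj, rfl⟩, by rintro h _ ⟨j, hj, rfl⟩; exact h j hj⟩

lemma hiddenCoeffs_mono (X : Matrix (Fin n) (Fin k) K) {S T : Finset (Fin n)} (h : S ⊆ T) :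
    hiddenCoeffs X S ≤ hiddenCoeffs X T := fun _ hc =>
  mem_hiddenCoeffs.mpr fun j hj => mem_hiddenCoeffs.mp hc j fun hj' => hj (h hj')

lemma finrank_hiddenCoeffs_add (X : Matrix (Fin n) (Fin k) K) (S : Finset (Fin n)) :
    Module.finrank K (hiddenCoeffs X S) +
      Module.finrank K (Submodule.span K (X.row '' {j | j ∉ S})) = k :=
  finrank_annihilator_add ((Set.toFinite _).image _)

/-- If `c` is supported at `j`, subtracting a multiple of `c` from `v` frees `j` from the support. -/
lemma sub_smul_mem_hiddenCoeffs_erase [DecidableEq K] {X : Matrix (Fin n) (Fin k) K}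
    {S : Finset (Fin n)} {v c : Fin k → K} (hv : v ∈ hiddenCoeffs X S) (hc : c ∈ hiddenCoeffs X S)
    {j : Fin n} (hj : X.mulVec c j ≠ 0) :
    v - (X.mulVec v j / X.mulVec c j) • c ∈ hiddenCoeffs X (S.erase j) := by
  rw [mem_hiddenCoeffs]
  intro l hl
  rw [Matrix.mulVec_sub, Matrix.mulVec_smul, Pi.sub_apply, Pi.smul_apply, smul_eq_mul]
  by_cases hlj : l = j
  · subst hlj
    rw [div_mul_cancel₀ _ hj, sub_self]
  · have hlS : l ∉ S := fun h => hl (Finset.mem_erase.mpr ⟨hlj, h⟩)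
    rw [mem_hiddenCoeffs.mp hv l hlS, mem_hiddenCoeffs.mp hc l hlS]
    simp

/-- If some vector supported on `T` is seen by `G`, then `T` contains a set `S` which is minimal
among the supports of one-dimensional families of hidden vectors, and whose family is seen by `G`.
The set `S` is a minimal support of a vector seen by `G`: eliminating a coordinate shows that the
hidden vectors of `S` are the multiples of one vector. -/
lemma exists_minimal_hidden [DecidableEq K] {r : ℕ} {X : Matrix (Fin n) (Fin k) K}
    (hX : ∀ c, X.mulVec c = 0 → c = 0) (G : Matrix (Fin r) (Fin k) K) {T : Finset (Fin n)}
    (hT : ∃ c ∈ hiddenCoeffs X T, G.mulVec c ≠ 0) :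
    ∃ S ⊆ T, Minimal (fun S => Module.finrank K (hiddenCoeffs X S) = 1) S ∧
      ∀ c ∈ hiddenCoeffs X S, G.mulVec c = 0 → c = 0 := by
  obtain ⟨S, hST, hS⟩ := exists_minimal_le_of_wellFoundedLT
    (fun S => ∃ c ∈ hiddenCoeffs X S, G.mulVec c ≠ 0) T hT
  obtain ⟨v, hv, hGv⟩ := hS.prop
  have hXne : ∀ c, c ≠ 0 → ∃ j, X.mulVec c j ≠ 0 := by
    intro c hc
    by_contra! h
    exact hc (hX c (funext h))
  have hmemS : ∀ c ∈ hiddenCoeffs X S, ∀ j, X.mulVec c j ≠ 0 → j ∈ S := by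
    intro c hc j hj
    by_contra hjS
    exact hj (mem_hiddenCoeffs.mp hc j hjS)
  have herase : ∀ j ∈ S, ∀ c ∈ hiddenCoeffs X (S.erase j), G.mulVec c = 0 := by
    intro j hj c hc
    by_contra hGc
    exact Finset.notMem_erase j S (hS.le_of_le ⟨c, hc, hGc⟩ (Finset.erase_subset j S) hj)
  have hinj : ∀ c ∈ hiddenCoeffs X S, G.mulVec c = 0 → c = 0 := by
    intro c hc hGc
    by_contra hc0
    obtain ⟨j, hj⟩ := hXne c hc0
    have h := herase j (hmemS c hc j hj) _ (sub_smul_mem_hiddenCoeffs_erase hv hc hj)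
    rw [Matrix.mulVec_sub, Matrix.mulVec_smul, hGc, smul_zero, sub_zero] at h
    exact hGv h
  have hv0 : v ≠ 0 := by
    rintro rfl
    exact hGv (Matrix.mulVec_zero G)
  have hone : Module.finrank K (hiddenCoeffs X S) = 1 := by
    refine (finrank_eq_one_iff_of_nonzero' (⟨v, hv⟩ : hiddenCoeffs X S)
      (fun h => hv0 (congrArg Subtype.val h))).mpr ?_
    rintro ⟨w, hw⟩
    obtain ⟨j, hj⟩ := hXne v hv0
    have hmem := sub_smul_mem_hiddenCoeffs_erase hw hv hj
    have h0 := hinj _ (hiddenCoeffs_mono X (Finset.erase_subset j S) hmem)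
      (herase j (hmemS v hv j hj) _ hmem)
    exact ⟨_, Subtype.ext (sub_eq_zero.mp h0).symm⟩
  refine ⟨S, hST, ⟨hone, fun S' hS' hle => ?_⟩, hinj⟩
  have heq := Submodule.eq_of_le_of_finrank_eq (hiddenCoeffs_mono X hle) (hS'.trans hone.symm)
  exact hS.le_of_le ⟨v, heq ▸ hv, hGv⟩ hle

/-- If `S` consists of the indices of the rows outside a hyperplane spanned by rows, the hidden vectors
of `S` form a line. -/
lemma finrank_hidden_of_flat {X : Matrix (Fin n) (Fin k) K} {W : Set (Fin n)}
    (hW : Module.finrank K (Submodule.span K (X.row '' W)) + 1 = k) {S : Finset (Fin n)}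
    (hS : ∀ j, j ∈ S ↔ X.row j ∉ Submodule.span K (X.row '' W)) :
    Submodule.span K (X.row '' {j | j ∉ S}) = Submodule.span K (X.row '' W) ∧
      Module.finrank K (hiddenCoeffs X S) = 1 := by
  have hspan : Submodule.span K (X.row '' {j | j ∉ S}) = Submodule.span K (X.row '' W) := by
    apply le_antisymm
    · rw [Submodule.span_le]
      rintro _ ⟨j, hj, rfl⟩
      exact not_not.mp fun h => hj ((hS j).mpr h)
    · apply Submodule.span_mono
      apply Set.image_mono
      intro j hj hjS
      exact (hS j).mp hjS (Submodule.subset_span ⟨j, hj, rfl⟩)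
  refine ⟨hspan, ?_⟩
  have h := finrank_hiddenCoeffs_add X S
  rw [hspan] at h
  omega

end Hidden

lemma setOf_mem_map_row {K : Type} {n k : ℕ} (X : Matrix (Fin n) (Fin k) K) (W : List (Fin n)) :
    {v | v ∈ W.map X.row} = X.row '' {j | j ∈ W} := by
  ext v
  exact List.mem_map

/-! ### The enumeration of minimal sets and the selection -/

section Enumeration

variable {K : Type} [Field K] [DecidableEq K] {n k : ℕ}

/-- When the rows of `W` span a hyperplane, the rank test on `W ∪ {j}` decides whether row `j` lies in
it. -/
lemma splitByRank_value (X : Matrix (Fin n) (Fin k) K) (W : List (Fin n))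
    (hW : Module.finrank K (Submodule.span K (X.row '' {j | j ∈ W})) + 1 = k)
    [DecidablePred fun j => X.row j ∈ Submodule.span K (X.row '' {j | j ∈ W})]
    (js : List (Fin n)) :
    (splitByRank X ((W.map X.row).map List.ofFn) js).value =
      (js.filter fun j => X.row j ∈ Submodule.span K (X.row '' {j | j ∈ W}),
        js.filter fun j => X.row j ∉ Submodule.span K (X.row '' {j | j ∈ W})) := by
  induction js with
  | nil => rfl
  | cons j js ih =>
    have hrank : (rankOf k (List.ofFn (X j) :: (W.map X.row).map List.ofFn)).value + 1 = k ↔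
        X.row j ∈ Submodule.span K (X.row '' {j | j ∈ W}) := by
      change (rankOf k (List.ofFn (X.row j) :: _)).value + 1 = k ↔ _
      have h := rankOf_value (X.row j :: W.map X.row)
      have hset : {v | v ∈ X.row j :: W.map X.row} = insert (X.row j) (X.row '' {j | j ∈ W}) := by
        rw [← setOf_mem_map_row]
        ext v
        exact List.mem_cons
      rw [List.map_cons] at h
      rw [h, hset]
      constructor
      · intro h1
        by_contra hj
        have h2 := Submodule.finrank_sup_span_singleton hj
        rw [Submodule.span_insert, sup_comm, h2] at h1
        omega
      · intro hj
        rwa [Submodule.span_insert_eq_span hj]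
    simp only [splitByRank, value_bind, value_step, value_ite, readRow_value, ih,
      decide_eq_true_eq]
    by_cases hj : X.row j ∈ Submodule.span K (X.row '' {j | j ∈ W})
    · rw [if_pos (hrank.mpr hj)]
      simp [hj]
    · rw [if_neg fun h => hj (hrank.mp h)]
      simp [hj]

lemma mem_closeCandidates_value (X : Matrix (Fin n) (Fin k) K) (idx : List (Fin n))
    (Ws : List (List (Fin n))) (e : List (Fin n) × List (Fin n)) :
    e ∈ (closeCandidates X idx Ws).value ↔
      ∃ W ∈ Ws, Module.finrank K (Submodule.span K (X.row '' {j | j ∈ W})) + 1 = k ∧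
        e = (splitByRank X ((W.map X.row).map List.ofFn) idx).value := by
  induction Ws with
  | nil => simp [closeCandidates]
  | cons W Ws ih =>
    have hrank := rankOf_value (W.map X.row)
    rw [setOf_mem_map_row] at hrank
    simp only [closeCandidates, value_bind, value_step, value_ite, readRows_value, hrank,
      decide_eq_true_eq]
    split_ifs with h
    · simp [ih, h]
    · simp [ih, h]

lemma mem_enumerateMinimalSets_value (X : Matrix (Fin n) (Fin k) K)
    (e : List (Fin n) × List (Fin n)) :
    e ∈ (enumerateMinimalSets X).value ↔
      ∃ W : List (Fin n), (W.Sublist (List.finRange n) ∧ W.length = k - 1) ∧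
        Module.finrank K (Submodule.span K (X.row '' {j | j ∈ W})) + 1 = k ∧
        e = (splitByRank X ((W.map X.row).map List.ofFn) (List.finRange n)).value := by
  simp only [enumerateMinimalSets, value_bind, allIndices_value, mem_closeCandidates_value,
    mem_subsetsOfSize_value]

/-- In an enumerated pair `(W', S)`, the lists are duplicate-free and complementary. -/
lemma enumerated_spec {X : Matrix (Fin n) (Fin k) K} {e : List (Fin n) × List (Fin n)}
    (he : e ∈ (enumerateMinimalSets X).value) :
    e.1.Sublist (List.finRange n) ∧ e.2.Sublist (List.finRange n) ∧ ∀ j, j ∈ e.1 ↔ j ∉ e.2 := by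
  classical
  obtain ⟨W, -, hW, rfl⟩ := (mem_enumerateMinimalSets_value X e).mp he
  rw [splitByRank_value X W hW]
  refine ⟨List.filter_sublist, List.filter_sublist, fun j => ?_⟩
  simp

/-- The enumeration lists exactly the minimal sets whose hidden vectors form a line. -/
lemma enumerated_iff_minimal (X : Matrix (Fin n) (Fin k) K) (S : Finset (Fin n)) :
    (∃ e ∈ (enumerateMinimalSets X).value, e.2.toFinset = S) ↔
      Minimal (fun T => Module.finrank K (hiddenCoeffs X T) = 1) S := by
  classical
  constructor
  · rintro ⟨e, he, rfl⟩
    obtain ⟨W, -, hW, rfl⟩ := (mem_enumerateMinimalSets_value X e).mp he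
    rw [splitByRank_value X W hW]
    set S := (List.filter (fun j => X.row j ∉ Submodule.span K (X.row '' {j | j ∈ W}))
      (List.finRange n)).toFinset with hSdef
    have hS : ∀ j, j ∈ S ↔ X.row j ∉ Submodule.span K (X.row '' {j | j ∈ W}) := by
      intro j
      simp [hSdef]
    obtain ⟨hspan, hone⟩ := finrank_hidden_of_flat hW hS
    refine ⟨hone, fun T hT hTS j hj => ?_⟩
    by_contra hjT
    have hle : Submodule.span K (X.row '' {j | j ∈ W}) ≤
        Submodule.span K (X.row '' {j | j ∉ T}) := by
      rw [← hspan]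
      exact Submodule.span_mono (Set.image_mono fun l hl hlT => hl (hTS hlT))
    have hdim := finrank_hiddenCoeffs_add X T
    rw [hT] at hdim
    have heq := Submodule.eq_of_le_of_finrank_eq hle (by omega)
    refine (hS j).mp hj ?_
    rw [heq]
    exact Submodule.subset_span ⟨j, hjT, rfl⟩
  · intro hS
    have hdim := finrank_hiddenCoeffs_add X S
    rw [hS.prop] at hdim
    obtain ⟨κ, a, ha, hspan, hli⟩ :=
      exists_linearIndependent' K (fun j : {j // j ∉ S} => X.row j.1)
    have : Finite κ := Finite.of_injective a ha
    cases nonempty_fintype κ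
    have hrange : Set.range (fun j : {j // j ∉ S} => X.row j.1) = X.row '' {j | j ∉ S} := by
      rw [← Function.comp_def X.row Subtype.val, Set.range_comp]
      congr 1
      exact Subtype.range_coe
    let W₀ : Finset (Fin n) := Finset.univ.image (Subtype.val ∘ a)
    let W : List (Fin n) := (List.finRange n).filter (· ∈ W₀)
    have hWmem : ∀ j, j ∈ W ↔ j ∈ W₀ := fun j => by simp [W]
    have hWlen : W.length = k - 1 := by
      have h1 : W.toFinset = W₀ := by
        ext j
        rw [List.mem_toFinset, hWmem]
      have h2 : W.Nodup := (List.nodup_finRange n).filter _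
      rw [← List.toFinset_card_of_nodup h2, h1,
        Finset.card_image_of_injective _ (Subtype.val_injective.comp ha), Finset.card_univ,
        ← finrank_span_eq_card hli, hspan, hrange]
      omega
    have hWspan : Submodule.span K (X.row '' {j | j ∈ W}) =
        Submodule.span K (X.row '' {j | j ∉ S}) := by
      rw [← hrange, ← hspan]
      congr 1
      ext v
      constructor
      · rintro ⟨j, hj, rfl⟩
        obtain ⟨x, -, rfl⟩ := Finset.mem_image.mp ((hWmem j).mp hj)
        exact ⟨x, rfl⟩
      · rintro ⟨x, rfl⟩
        exact ⟨_, (hWmem _).mpr (Finset.mem_image_of_mem _ (Finset.mem_univ x)), rfl⟩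
    have hW : Module.finrank K (Submodule.span K (X.row '' {j | j ∈ W})) + 1 = k := by
      rw [hWspan]
      omega
    refine ⟨_, (mem_enumerateMinimalSets_value X _).mpr
      ⟨W, ⟨List.filter_sublist, hWlen⟩, hW, rfl⟩, ?_⟩
    rw [splitByRank_value X W hW]
    set S' := (List.filter (fun j => X.row j ∉ Submodule.span K (X.row '' {j | j ∈ W}))
      (List.finRange n)).toFinset with hSdef
    have hS' : ∀ j, j ∈ S' ↔ X.row j ∉ Submodule.span K (X.row '' {j | j ∈ W}) := by
      intro j
      simp [hSdef]
    have hle : S' ≤ S := by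
      intro j hj
      by_contra hjS
      apply (hS' j).mp hj
      rw [hWspan]
      exact Submodule.subset_span ⟨j, hjS, rfl⟩
    exact le_antisymm hle (hS.le_of_le (finrank_hidden_of_flat hW hS').2 hle)

/-- The rank test accepts `S` exactly when no nonzero hidden vector of `S` is annihilated by `F`. -/
lemma fullRankCheck_iff {r : ℕ} (F : Matrix (Fin r) (Fin n) K) (X : Matrix (Fin n) (Fin k) K)
    {W' : List (Fin n)} {S : Finset (Fin n)} (h : ∀ j, j ∈ W' ↔ j ∉ S) :
    (fullRankCheck X (matMul F X).value W').value = true ↔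
      ∀ c ∈ hiddenCoeffs X S, (F * X).mulVec c = 0 → c = 0 := by
  simp only [fullRankCheck, value_bind, value_step, readRows_value, matMul_value,
    appendLists_value, ← List.map_append, rankOf_value, decide_eq_true_eq]
  rw [finrank_span_eq_iff (List.finite_toSet _)]
  refine forall_congr' fun c => ?_
  rw [mem_hiddenCoeffs, ← and_imp, funext_iff (f := (F * X).mulVec c)]
  apply imp_congr _ Iff.rfl
  simp only [Set.mem_ofPred_eq, List.mem_append, List.mem_map, List.mem_finRange, true_and]
  constructor
  · exact fun hc => ⟨fun j hj => hc _ (Or.inl ⟨j, (h j).mpr hj, rfl⟩),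
      fun i => hc _ (Or.inr ⟨i, rfl⟩)⟩
  · rintro ⟨h1, h2⟩ _ (⟨j, hj, rfl⟩ | ⟨i, rfl⟩)
    · exact h1 j ((h j).mp hj)
    · exact h2 i

/-- The selection returns either the full index list or an accepted set, and nothing shorter was
accepted. -/
lemma smallestPassing_spec (X : Matrix (Fin n) (Fin k) K) (FX : List (List K))
    (idx : List (Fin n)) (es : List (List (Fin n) × List (Fin n))) :
    ((smallestPassing X FX idx es).value = idx ∨
      ∃ e ∈ es, (fullRankCheck X FX e.1).value = true ∧
        (smallestPassing X FX idx es).value = e.2) ∧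
    (smallestPassing X FX idx es).value.length ≤ idx.length ∧
    ∀ e ∈ es, (fullRankCheck X FX e.1).value = true →
      (smallestPassing X FX idx es).value.length ≤ e.2.length := by
  induction es with
  | nil => simp [smallestPassing]
  | cons e es ih =>
    simp only [smallestPassing, value_bind, value_step, shorter_value, List.forall_mem_cons]
    simp only [List.mem_cons, exists_eq_or_imp]
    obtain ⟨h1, h2, h3⟩ := ih
    generalize (smallestPassing X FX idx es).value = b at *
    by_cases hok : (fullRankCheck X FX e.1).value = true
    · simp only [hok, if_true, true_and, forall_const]
      split_ifs with hle
      · exact ⟨Or.inr (Or.inl rfl), hle.trans h2, le_rfl, fun e' he' h => hle.trans (h3 e' he' h)⟩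
      · exact ⟨h1.imp_right Or.inr, h2, (not_le.mp hle).le, h3⟩
    · simp only [hok, if_false, false_and, false_or, false_imp_iff, true_and, Bool.false_eq_true]
      split_ifs with hle
      · exact ⟨Or.inl rfl, le_rfl, fun e' he' h => hle.trans (h3 e' he' h)⟩
      · exact ⟨h1, h2, h3⟩

lemma smallestOverEigenvalues_spec {r : ℕ} (F : Matrix (Fin r) (Fin n) K) (idx : List (Fin n))
    (Xs : List ((k : ℕ) × Matrix (Fin n) (Fin k) K)) :
    ((smallestOverEigenvalues F idx Xs).value = idx ∨
      ∃ X ∈ Xs, ∃ e ∈ (enumerateMinimalSets X.2).value,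
        (fullRankCheck X.2 (matMul F X.2).value e.1).value = true ∧
        (smallestOverEigenvalues F idx Xs).value = e.2) ∧
    (smallestOverEigenvalues F idx Xs).value.length ≤ idx.length ∧
    ∀ X ∈ Xs, ∀ e ∈ (enumerateMinimalSets X.2).value,
      (fullRankCheck X.2 (matMul F X.2).value e.1).value = true →
      (smallestOverEigenvalues F idx Xs).value.length ≤ e.2.length := by
  induction Xs with
  | nil => simp [smallestOverEigenvalues]
  | cons X Xs ih =>
    simp only [smallestOverEigenvalues, value_bind, shorter_value, List.forall_mem_cons]
    simp only [List.mem_cons, exists_eq_or_imp]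
    obtain ⟨h1, h2, h3⟩ := ih
    obtain ⟨g1, g2, g3⟩ := smallestPassing_spec X.2 (matMul F X.2).value idx
      (enumerateMinimalSets X.2).value
    generalize (smallestOverEigenvalues F idx Xs).value = b at *
    generalize (smallestPassing X.2 (matMul F X.2).value idx (enumerateMinimalSets X.2).value).value
      = s at *
    split_ifs with hle
    · exact ⟨g1.imp_right Or.inl, g2, g3, fun Y hY e he h => hle.trans (h3 Y hY e he h)⟩
    · have hle' := (not_le.mp hle).le
      exact ⟨h1.imp_right Or.inr, h2, fun e he h => hle'.trans (g3 e he h), h3⟩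

end Enumeration

/-! ### Ranks of the sensor pencils -/

section Pencil

variable {n r : ℕ}

lemma blockColumns_one_mulVec {R : Type*} [Semiring R] (S : Finset (Fin n)) (x : Fin n → R)
    (j : Fin n) :
    (blockColumns (1 : Matrix (Fin n) (Fin n) R) S).mulVec x j = if j ∈ S then 0 else x j := by
  simp only [Matrix.mulVec, dotProduct, blockColumns, Matrix.of_apply, Matrix.one_apply]
  rw [Finset.sum_eq_single j]
  · split <;> simp
  · intro l _ hl
    split <;> simp [hl.symm]
  · simp

lemma blockColumns_mulVec_eq_zero {ι R : Type*} [Semiring R] (C : Matrix ι (Fin n) R)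
    {S : Finset (Fin n)} {x : Fin n → R} (hx : ∀ j ∉ S, x j = 0) :
    (blockColumns C S).mulVec x = 0 := by
  ext i
  simp only [Matrix.mulVec, dotProduct, blockColumns, Matrix.of_apply, Pi.zero_apply]
  refine Finset.sum_eq_zero fun j _ => ?_
  split_ifs with hj
  · exact zero_mul _
  · rw [hx j hj, mul_zero]

lemma blockColumns_one_mulVec_eq_zero_iff {R : Type*} [Semiring R] {S : Finset (Fin n)}
    {x : Fin n → R} :
    (blockColumns (1 : Matrix (Fin n) (Fin n) R) S).mulVec x = 0 ↔ ∀ j ∉ S, x j = 0 := by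
  refine ⟨fun h j hj => ?_, blockColumns_mulVec_eq_zero 1⟩
  have := congrFun h j
  rwa [blockColumns_one_mulVec, if_neg hj] at this

lemma sensorPencil_mulVec_eq_zero_iff {A : Matrix (Fin n) (Fin n) ℝ} {μ : ℂ} {S : Finset (Fin n)}
    {x : Fin n → ℂ} :
    (sensorPencil A μ S).mulVec x = 0 ↔
      x ∈ Module.End.eigenspace (Matrix.toLin' (complexify A)) μ ∧ ∀ j ∉ S, x j = 0 := by
  rw [sensorPencil, Matrix.fromRows_mulVec, ← blockColumns_one_mulVec_eq_zero_iff,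
    Module.End.mem_eigenspace_iff, Matrix.toLin'_apply, ← sub_eq_zero (b := μ • x)]
  have h : (complexify A - μ • (1 : Matrix (Fin n) (Fin n) ℂ)).mulVec x =
      (complexify A).mulVec x - μ • x := by
    rw [Matrix.sub_mulVec, Matrix.smul_mulVec, Matrix.one_mulVec]
  rw [h, ← Sum.elim_zero_zero, Sum.elim_eq_iff]

variable {A : Matrix (Fin n) (Fin n) ℝ} (E : EigenData A)

lemma EigenData.eq_zero_of_mulVec_eq_zero (i : Fin E.q) (c : Fin (E.mult i) → ℂ)
    (hc : (E.basis i).mulVec c = 0) : c = 0 :=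
  Matrix.mulVec_injective_iff.mpr (E.basis_linearIndependent i)
    (hc.trans (Matrix.mulVec_zero _).symm)

lemma EigenData.mem_eigenspace_iff (i : Fin E.q) (x : Fin n → ℂ) :
    x ∈ Module.End.eigenspace (Matrix.toLin' (complexify A)) (E.eigenvalue i) ↔
      ∃ c, (E.basis i).mulVec c = x := by
  rw [← E.basis_span, ← Matrix.range_mulVecLin]
  rfl

lemma EigenData.ker_sensorPencil (i : Fin E.q) (S : Finset (Fin n)) :
    LinearMap.ker (sensorPencil A (E.eigenvalue i) S).mulVecLin =
      (hiddenCoeffs (E.basis i) S).map (E.basis i).mulVecLin := by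
  ext x
  rw [LinearMap.mem_ker, Matrix.mulVecLin_apply, sensorPencil_mulVec_eq_zero_iff,
    E.mem_eigenspace_iff]
  constructor
  · rintro ⟨⟨c, rfl⟩, h⟩
    exact ⟨c, mem_hiddenCoeffs.mpr h, rfl⟩
  · rintro ⟨c, hc, rfl⟩
    exact ⟨⟨c, rfl⟩, mem_hiddenCoeffs.mp hc⟩

lemma EigenData.rank_sensorPencil_add (i : Fin E.q) (S : Finset (Fin n)) :
    (sensorPencil A (E.eigenvalue i) S).rank +
      Module.finrank ℂ (hiddenCoeffs (E.basis i) S) = n := by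
  have h := LinearMap.finrank_range_add_finrank_ker (sensorPencil A (E.eigenvalue i) S).mulVecLin
  rw [E.ker_sensorPencil, Module.finrank_fin_fun] at h
  have hinj : Function.Injective (E.basis i).mulVecLin :=
    (injective_iff_map_eq_zero _).mpr (E.eq_zero_of_mulVec_eq_zero i)
  rwa [← (Submodule.equivMapOfInjective _ hinj (hiddenCoeffs (E.basis i) S)).finrank_eq] at h

lemma EigenData.rank_sensorPencil_add_one (i : Fin E.q) (S : Finset (Fin n)) :
    (sensorPencil A (E.eigenvalue i) S).rank + 1 = n ↔
      Module.finrank ℂ (hiddenCoeffs (E.basis i) S) = 1 := by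
  have h := E.rank_sensorPencil_add i S
  omega

lemma EigenData.rank_sensorPencilWith (F : Matrix (Fin r) (Fin n) ℝ) (i : Fin E.q)
    (S : Finset (Fin n)) :
    (sensorPencilWith A F (E.eigenvalue i) S).rank = n ↔
      ∀ c ∈ hiddenCoeffs (E.basis i) S, (complexify F * E.basis i).mulVec c = 0 → c = 0 := by
  have h := LinearMap.finrank_range_add_finrank_ker
    (sensorPencilWith A F (E.eigenvalue i) S).mulVecLin
  rw [Module.finrank_fin_fun] at h
  have hker : LinearMap.ker (sensorPencilWith A F (E.eigenvalue i) S).mulVecLin = ⊥ ↔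
      ∀ c ∈ hiddenCoeffs (E.basis i) S, (complexify F * E.basis i).mulVec c = 0 → c = 0 := by
    have hmem : ∀ x, x ∈ LinearMap.ker (sensorPencilWith A F (E.eigenvalue i) S).mulVecLin ↔
        x ∈ LinearMap.ker (sensorPencil A (E.eigenvalue i) S).mulVecLin ∧
          (complexify F).mulVec x = 0 := by
      intro x
      rw [LinearMap.mem_ker, Matrix.mulVecLin_apply, sensorPencilWith, Matrix.fromRows_mulVec,
        ← Sum.elim_zero_zero, Sum.elim_eq_iff, LinearMap.mem_ker, Matrix.mulVecLin_apply]
    rw [Submodule.eq_bot_iff]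
    simp only [hmem, E.ker_sensorPencil]
    constructor
    · intro h c hc hF
      refine E.eq_zero_of_mulVec_eq_zero i c (h _ ⟨⟨c, hc, rfl⟩, ?_⟩)
      exact (Matrix.mulVec_mulVec _ _ _).trans hF
    · rintro h _ ⟨⟨c, hc, rfl⟩, hF⟩
      rw [Matrix.mulVecLin_apply, Matrix.mulVec_mulVec] at hF
      rw [h c hc hF, map_zero]
  rw [← hker, ← Submodule.finrank_eq_zero, Matrix.rank]
  omega

end Pencil

/-! ### Trajectories and hidden modes -/

section Dynamics

variable {n m r : ℕ}

/-- `S` hides a mode seen by `F`: some eigenvector of `A` is supported on `S` and is not annihilated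
by `F`. -/
def HidesMode (A : Matrix (Fin n) (Fin n) ℝ) (F : Matrix (Fin r) (Fin n) ℝ)
    (S : Finset (Fin n)) : Prop :=
  ∃ (μ : ℂ) (v : Fin n → ℂ), (complexify A).mulVec v = μ • v ∧ (∀ j ∉ S, v j = 0) ∧
    (complexify F).mulVec v ≠ 0

lemma re_complexify_mulVec (M : Matrix (Fin r) (Fin n) ℝ) (v : Fin n → ℂ) (i : Fin r) :
    ((complexify M).mulVec v i).re = M.mulVec (fun j => (v j).re) i := by
  simp [Matrix.mulVec, dotProduct, complexify]

lemma im_complexify_mulVec (M : Matrix (Fin r) (Fin n) ℝ) (v : Fin n → ℂ) (i : Fin r) :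
    ((complexify M).mulVec v i).im = M.mulVec (fun j => (v j).im) i := by
  simp [Matrix.mulVec, dotProduct, complexify]

lemma complexify_mulVec_ofReal (M : Matrix (Fin r) (Fin n) ℝ) (x : Fin n → ℝ) :
    (complexify M).mulVec (fun j => (x j : ℂ)) = fun i => ((M.mulVec x i : ℝ) : ℂ) := by
  ext i
  simp [Matrix.mulVec, dotProduct, complexify]

/-- The real part of a complex mode `e^{μ t} v` is a trajectory without input. -/
lemma isTrajectory_re_mode (A : Matrix (Fin n) (Fin n) ℝ) (B : Matrix (Fin n) (Fin m) ℝ) {μ : ℂ}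
    {v : Fin n → ℂ} (hv : (complexify A).mulVec v = μ • v) :
    IsTrajectory A B 0 (fun j => (v j).re) (fun t j => (Complex.exp (t * μ) * v j).re) := by
  have hderiv : ∀ t : ℝ, HasDerivAt (fun (t : ℝ) (j : Fin n) => (Complex.exp (t * μ) * v j).re)
      (A.mulVec fun j => (Complex.exp (t * μ) * v j).re) t := by
    intro t
    rw [hasDerivAt_pi]
    intro j
    have hA : (A.mulVec fun j => (Complex.exp (t * μ) * v j).re) j =
        (Complex.exp (t * μ) * μ * v j).re := by
      rw [← re_complexify_mulVec A (fun j => Complex.exp (t * μ) * v j)]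
      change ((complexify A).mulVec (Complex.exp (t * μ) • v) j).re = _
      rw [Matrix.mulVec_smul, hv]
      simp only [Pi.smul_apply, smul_eq_mul, mul_assoc]
    rw [hA]
    have h1 : HasDerivAt (fun t : ℝ => (t : ℂ) * μ) μ t := by
      simpa using (Complex.ofRealCLM.hasDerivAt (x := t)).mul_const μ
    have h2 := h1.cexp.mul_const (v j)
    exact Complex.reCLM.hasFDerivAt.comp_hasDerivAt t h2
  have hcont : Continuous fun (t : ℝ) (j : Fin n) => (Complex.exp (t * μ) * v j).re :=
    continuous_iff_continuousAt.mpr fun t => (hderiv t).continuousAt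
  refine ⟨fun t _ => intervalIntegrable_const, hcont.continuousOn, fun t _ => ?_⟩
  have hint := intervalIntegral.integral_eq_sub_of_hasDerivAt (a := 0) (b := t)
    (fun s _ => hderiv s)
    ((Continuous.matrix_mulVec continuous_const hcont).intervalIntegrable _ _)
  simp only [Pi.zero_apply, Matrix.mulVec_zero, add_zero]
  rw [hint]
  ext j
  simp

/-- A hidden mode yields a real trajectory without input that stays supported on `S` and whose initial
state is seen by `F`. -/
lemma HidesMode.exists_trajectory {A : Matrix (Fin n) (Fin n) ℝ} {F : Matrix (Fin r) (Fin n) ℝ}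
    {S : Finset (Fin n)} (h : HidesMode A F S) (B : Matrix (Fin n) (Fin m) ℝ) :
    ∃ (x : Fin n → ℝ) (ξ : ℝ → Fin n → ℝ), IsTrajectory A B 0 x ξ ∧ (∀ t, ∀ j ∉ S, ξ t j = 0) ∧
      F.mulVec x ≠ 0 := by
  have key : ∀ (μ : ℂ) (v : Fin n → ℂ), (complexify A).mulVec v = μ • v → (∀ j ∉ S, v j = 0) →
      F.mulVec (fun j => (v j).re) ≠ 0 → ∃ (x : Fin n → ℝ) (ξ : ℝ → Fin n → ℝ),
        IsTrajectory A B 0 x ξ ∧ (∀ t, ∀ j ∉ S, ξ t j = 0) ∧ F.mulVec x ≠ 0 := fun μ v hv hS hF =>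
    ⟨_, _, isTrajectory_re_mode A B hv, fun t j hj => by simp [hS j hj], hF⟩
  obtain ⟨μ, v, hv, hS, hF⟩ := h
  by_cases hre : F.mulVec (fun j => (v j).re) = 0
  · -- the imaginary part of `v` is the real part of the eigenvector `-i v`
    refine key μ (-Complex.I • v) ?_ (fun j hj => by simp [hS j hj]) ?_
    · rw [Matrix.mulVec_smul, hv, smul_comm]
    · intro him
      have him' : F.mulVec (fun j => (v j).im) = 0 := by simpa using him
      apply hF
      ext i
      apply Complex.ext
      · rw [re_complexify_mulVec, hre]
        rfl
      · rw [im_complexify_mulVec, him']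
        rfl
  · exact key μ v hv hS hre

lemma isTrajectory_zero (A : Matrix (Fin n) (Fin n) ℝ) (B : Matrix (Fin n) (Fin m) ℝ) :
    IsTrajectory A B 0 0 0 :=
  ⟨fun _ _ => intervalIntegrable_const, continuousOn_const, fun t _ => by simp⟩

lemma HidesMode.blocksEveryOutput {A : Matrix (Fin n) (Fin n) ℝ} {F : Matrix (Fin r) (Fin n) ℝ}
    {S : Finset (Fin n)} (h : HidesMode A F S) (B : Matrix (Fin n) (Fin m) ℝ) :
    BlocksEveryOutput A B F S := by
  obtain ⟨x, ξ, hξ, hS, hF⟩ := h.exists_trajectory B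
  intro p C hinf
  obtain ⟨tf, -, htf⟩ := hinf 0 0 0 (isTrajectory_zero A B)
  refine hF ?_
  rw [htf x ξ hξ fun t _ => ?_, Matrix.mulVec_zero]
  rw [blockColumns_mulVec_eq_zero C (hS t), Pi.zero_apply, Matrix.mulVec_zero]

lemma HidesMode.blocksDedicated {A : Matrix (Fin n) (Fin n) ℝ} {F : Matrix (Fin r) (Fin n) ℝ}
    {S : Finset (Fin n)} (h : HidesMode A F S) (B : Matrix (Fin n) (Fin m) ℝ) :
    BlocksDedicated A B F S := by
  obtain ⟨x, ξ, hξ, hS, hF⟩ := h.exists_trajectory B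
  intro hobs
  refine hF ?_
  rw [hobs x 0 0 ξ 0 hξ (isTrajectory_zero A B) fun t _ => ?_, Matrix.mulVec_zero]
  rw [blockColumns_mulVec_eq_zero _ (hS t), Pi.zero_apply, Matrix.mulVec_zero]

/-- The difference of two trajectories with the same input solves `η' = A η`. -/
lemma IsTrajectory.sub_eq_integral {A : Matrix (Fin n) (Fin n) ℝ} {B : Matrix (Fin n) (Fin m) ℝ}
    {u : ℝ → Fin m → ℝ} {x₁ x₂ : Fin n → ℝ} {ξ₁ ξ₂ : ℝ → Fin n → ℝ}
    (h₁ : IsTrajectory A B u x₁ ξ₁) (h₂ : IsTrajectory A B u x₂ ξ₂) {t : ℝ} (ht : 0 ≤ t) :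
    ξ₁ t - ξ₂ t = (x₁ - x₂) + ∫ s in (0 : ℝ)..t, A.mulVec (ξ₁ s - ξ₂ s) := by
  have hint : ∀ (x : Fin n → ℝ) (ξ : ℝ → Fin n → ℝ), IsTrajectory A B u x ξ →
      IntervalIntegrable (fun s => A.mulVec (ξ s) + B.mulVec (u s)) volume 0 t := by
    intro x ξ h
    refine IntervalIntegrable.add ?_ ?_
    · apply ContinuousOn.intervalIntegrable
      rw [Set.uIcc_of_le ht]
      exact (Continuous.matrix_mulVec continuous_const continuous_id).comp_continuousOn
        (h.continuousOn.mono Set.Icc_subset_Ici_self)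
    · have hu := h.input_integrable t ht
      exact ⟨(LinearMap.toContinuousLinearMap B.mulVecLin).integrable_comp hu.1,
        (LinearMap.toContinuousLinearMap B.mulVecLin).integrable_comp hu.2⟩
  rw [h₁.eq_integral t ht, h₂.eq_integral t ht, add_sub_add_comm,
    ← intervalIntegral.integral_sub (hint _ _ h₁) (hint _ _ h₂)]
  congr 2
  ext s
  rw [Matrix.mulVec_sub, add_sub_add_right_eq_sub]

/-- If `g` is continuous on `[0, 1]` and all integrals `∫₀ᵗ g` vanish there, then so does `g`. -/
lemma eq_zero_of_forall_integral_eq_zero {g : ℝ → ℝ} (hg : ContinuousOn g (Set.Icc 0 1))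
    (h : ∀ t ∈ Set.Icc (0 : ℝ) 1, ∫ s in (0 : ℝ)..t, g s = 0) :
    ∀ t ∈ Set.Icc (0 : ℝ) 1, g t = 0 := by
  have hopen : Set.EqOn g 0 (Set.Ioo 0 1) := by
    intro t ht
    have hmem : Set.Icc (0 : ℝ) 1 ∈ nhds t := Icc_mem_nhds ht.1 ht.2
    have hd : HasDerivAt (fun u => ∫ s in (0 : ℝ)..u, g s) (g t) t := by
      refine intervalIntegral.integral_hasDerivAt_right ?_ ?_ (hg.continuousAt hmem)
      · apply ContinuousOn.intervalIntegrable
        rw [Set.uIcc_of_le ht.1.le]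
        exact hg.mono (Set.Icc_subset_Icc_right ht.2.le)
      · exact ⟨_, hmem, hg.aestronglyMeasurable measurableSet_Icc⟩
    have h0 : HasDerivAt (fun u => ∫ s in (0 : ℝ)..u, g s) 0 t := by
      refine (hasDerivAt_const t (0 : ℝ)).congr_of_eventuallyEq ?_
      filter_upwards [hmem] with u hu using h u hu
    exact hd.unique h0
  have hcl : Set.EqOn g 0 (Set.Icc 0 1) := by
    refine hopen.of_subset_closure hg continuousOn_const Set.Ioo_subset_Icc_self ?_
    rw [closure_Ioo zero_ne_one]
  exact hcl

/-- A solution of `η' = A η` whose coordinates outside `S` vanish on `[0, 1]` starts in the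
unobservable subspace. -/
lemma pow_mulVec_eq_zero_of_integral {A : Matrix (Fin n) (Fin n) ℝ} {η : ℝ → Fin n → ℝ}
    {x : Fin n → ℝ} {S : Finset (Fin n)} (hcont : ContinuousOn η (Set.Ici 0))
    (hη : ∀ t, 0 ≤ t → η t = x + ∫ s in (0 : ℝ)..t, A.mulVec (η s))
    (hS : ∀ t ∈ Set.Icc (0 : ℝ) 1, ∀ j ∉ S, η t j = 0) (k : ℕ) :
    ∀ j ∉ S, (A ^ k).mulVec x j = 0 := by
  have hcont' : ContinuousOn η (Set.Icc 0 1) := hcont.mono Set.Icc_subset_Ici_self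
  have key : ∀ k : ℕ, ∀ t ∈ Set.Icc (0 : ℝ) 1, ∀ j ∉ S, (A ^ k).mulVec (η t) j = 0 := by
    intro k
    induction k with
    | zero => simpa using hS
    | succ k ih =>
      intro t ht j hj
      let L : (Fin n → ℝ) →L[ℝ] ℝ :=
        LinearMap.toContinuousLinearMap ((LinearMap.proj j).comp (A ^ k).mulVecLin)
      have hL : ∀ y, L y = (A ^ k).mulVec y j := fun y => rfl
      have hA : ContinuousOn (fun s => A.mulVec (η s)) (Set.Icc 0 1) :=
        (Continuous.matrix_mulVec continuous_const continuous_id).comp_continuousOn hcont'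
      have hzero : (A ^ k).mulVec x j = 0 := by
        have h0 := ih 0 (by simp) j hj
        rwa [hη 0 le_rfl, intervalIntegral.integral_same, add_zero] at h0
      have hg := eq_zero_of_forall_integral_eq_zero (g := fun s => L (A.mulVec (η s)))
        (L.continuous.comp_continuousOn hA) (fun u hu => ?_) t ht
      · rw [pow_succ, ← Matrix.mulVec_mulVec]
        exact hg
      · have hint : IntervalIntegrable (fun s => A.mulVec (η s)) volume 0 u := by
          apply ContinuousOn.intervalIntegrable
          rw [Set.uIcc_of_le hu.1]
          exact hA.mono (Set.Icc_subset_Icc_right hu.2)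
        have hu' := ih u hu j hj
        rw [← hL, hη u hu.1, map_add, hL x, hzero, zero_add] at hu'
        exact (L.intervalIntegral_comp_comm hint).trans hu'
  intro j hj
  have h0 := key k 0 (by simp) j hj
  rwa [hη 0 le_rfl, intervalIntegral.integral_same, add_zero] at h0

lemma IsDiagonalizable.iSup_eigenspace_eq_top {A : Matrix (Fin n) (Fin n) ℝ}
    (hA : IsDiagonalizable A) :
    ⨆ μ, Module.End.eigenspace (Matrix.toLin' (complexify A)) μ = ⊤ := by
  obtain ⟨P, d, hP, hAP⟩ := hA
  have hcol : ∀ i, P.col i ∈ Module.End.eigenspace (Matrix.toLin' (complexify A)) (d i) := by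
    intro i
    rw [Module.End.mem_eigenspace_iff, Matrix.toLin'_apply, hAP]
    have h1 : P.col i = P.mulVec (Pi.single i 1) := (Matrix.mulVec_single_one P i).symm
    rw [h1, Matrix.mulVec_mulVec, Matrix.mul_assoc, Matrix.nonsing_inv_mul P hP, Matrix.mul_one,
      ← Matrix.mulVec_mulVec, Matrix.mulVec_single, ← Matrix.mulVec_smul]
    congr 1
    ext l
    simp [Matrix.col, Matrix.diagonal_apply, Pi.single_apply, eq_comm]
  rw [eq_top_iff]
  intro x _
  have hx : x = P.mulVec (P⁻¹.mulVec x) := by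
    rw [Matrix.mulVec_mulVec, Matrix.mul_nonsing_inv P hP, Matrix.one_mulVec]
  rw [hx, Matrix.mulVec_eq_sum]
  refine Submodule.sum_mem _ fun i _ => ?_
  rw [op_smul_eq_smul]
  exact Submodule.smul_mem _ _ (Submodule.mem_iSup_of_mem (d i) (hcol i))

/-- The unobservable subspace of a diagonalizable matrix is spanned by eigenvectors, so an initial
state in it that is seen by `F` yields a hidden mode. -/
lemma hidesMode_of_pow_mulVec {A : Matrix (Fin n) (Fin n) ℝ} (hA : IsDiagonalizable A)
    {F : Matrix (Fin r) (Fin n) ℝ} {S : Finset (Fin n)} {x : Fin n → ℝ}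
    (hx : ∀ k : ℕ, ∀ j ∉ S, (A ^ k).mulVec x j = 0) (hF : F.mulVec x ≠ 0) : HidesMode A F S := by
  let U : Submodule ℂ (Fin n → ℂ) :=
    { carrier := {y | ∀ k : ℕ, ∀ j ∉ S, ((complexify A) ^ k).mulVec y j = 0}
      add_mem' := fun {a b} ha hb k j hj => by
        rw [Matrix.mulVec_add, Pi.add_apply, ha k j hj, hb k j hj, add_zero]
      zero_mem' := fun k j _ => by rw [Matrix.mulVec_zero, Pi.zero_apply]
      smul_mem' := fun c y hy k j hj => by
        rw [Matrix.mulVec_smul, Pi.smul_apply, hy k j hj, smul_zero] }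
  have hinv : ∀ y ∈ U, Matrix.toLin' (complexify A) y ∈ U := by
    intro y hy k j hj
    rw [Matrix.toLin'_apply, Matrix.mulVec_mulVec, ← pow_succ]
    exact hy (k + 1) j hj
  have hxU : (fun j => (x j : ℂ)) ∈ U := by
    intro k j hj
    have hpow : (complexify A) ^ k = complexify (A ^ k) :=
      (map_pow (Complex.ofRealHom.mapMatrix (m := Fin n)) A k).symm
    rw [hpow, complexify_mulVec_ofReal]
    simp only [hx k j hj, Complex.ofReal_zero]
  have hspan := Submodule.inf_iSup_genEigenspace hinv 1
  change U ⊓ ⨆ μ, Module.End.eigenspace (Matrix.toLin' (complexify A)) μ = _ at hspan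
  rw [hA.iSup_eigenspace_eq_top, inf_top_eq] at hspan
  by_contra hno
  have hle : U ≤ LinearMap.ker (complexify F).mulVecLin := by
    rw [hspan]
    refine iSup_le fun μ v hv => ?_
    by_contra hFv
    refine hno ⟨μ, v, Module.End.mem_eigenspace_iff.mp hv.2, fun j hj => ?_, hFv⟩
    simpa using hv.1 0 j hj
  have h0 := hle hxU
  rw [LinearMap.mem_ker, Matrix.mulVecLin_apply, complexify_mulVec_ofReal] at h0
  exact hF (funext fun i => by simpa using congrFun h0 i)

/-- Two trajectories with the same input that agree outside `S` on `[0, 1]`, but whose initial states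
are told apart by `F`, reveal a hidden mode. -/
lemma hidesMode_of_trajectories {A : Matrix (Fin n) (Fin n) ℝ} (hA : IsDiagonalizable A)
    {B : Matrix (Fin n) (Fin m) ℝ} {F : Matrix (Fin r) (Fin n) ℝ} {S : Finset (Fin n)}
    {u : ℝ → Fin m → ℝ} {x₁ x₂ : Fin n → ℝ} {ξ₁ ξ₂ : ℝ → Fin n → ℝ}
    (h₁ : IsTrajectory A B u x₁ ξ₁) (h₂ : IsTrajectory A B u x₂ ξ₂)
    (h : ∀ t ∈ Set.Icc (0 : ℝ) 1, (blockColumns (1 : Matrix (Fin n) (Fin n) ℝ) S).mulVec (ξ₁ t) =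
      (blockColumns (1 : Matrix (Fin n) (Fin n) ℝ) S).mulVec (ξ₂ t))
    (hF : F.mulVec x₁ ≠ F.mulVec x₂) : HidesMode A F S := by
  refine hidesMode_of_pow_mulVec hA (x := x₁ - x₂)
    (pow_mulVec_eq_zero_of_integral (h₁.continuousOn.sub h₂.continuousOn)
      (fun t ht => h₁.sub_eq_integral h₂ ht) fun t ht => ?_) ?_
  · rw [← blockColumns_one_mulVec_eq_zero_iff]
    have ht' := h t ht
    rwa [← sub_eq_zero, ← Matrix.mulVec_sub] at ht'
  · rw [Matrix.mulVec_sub]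
    exact sub_ne_zero.mpr hF

lemma blocksEveryOutput_iff {A : Matrix (Fin n) (Fin n) ℝ} (hA : IsDiagonalizable A)
    (B : Matrix (Fin n) (Fin m) ℝ) (F : Matrix (Fin r) (Fin n) ℝ) (S : Finset (Fin n)) :
    BlocksEveryOutput A B F S ↔ HidesMode A F S := by
  refine ⟨fun h => ?_, fun h => h.blocksEveryOutput B⟩
  by_contra hno
  refine h n 1 fun x u ξ hξ => ⟨1, zero_le_one, fun x' ξ' hξ' heq => ?_⟩
  by_contra hF
  exact hno (hidesMode_of_trajectories hA hξ' hξ heq hF)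

lemma blocksDedicated_iff {A : Matrix (Fin n) (Fin n) ℝ} (hA : IsDiagonalizable A)
    (B : Matrix (Fin n) (Fin m) ℝ) (F : Matrix (Fin r) (Fin n) ℝ) (S : Finset (Fin n)) :
    BlocksDedicated A B F S ↔ HidesMode A F S := by
  refine ⟨fun h => ?_, fun h => h.blocksDedicated B⟩
  by_contra hno
  refine h fun x₁ x₂ u ξ₁ ξ₂ h₁ h₂ heq => ?_
  by_contra hF
  exact hno (hidesMode_of_trajectories hA h₁ h₂ (fun t ht => heq t ht.1) hF)

end Dynamics

/-! ### Running time -/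

lemma time_bind {α β : Type} (x : Timed α) (f : α → Timed β) :
    (x >>= f).time = x.time + (f x.value).time := rfl

lemma time_step {α : Type} (a : α) : (step a).time = 1 := rfl

section Lists

variable {α : Type}

lemma appendLists_time (l₁ l₂ : List α) : (appendLists l₁ l₂).time = l₁.length + 1 := by
  induction l₁ with
  | nil => rfl
  | cons a l ih => simp [appendLists, time_bind, time_step, ih]

lemma consAll_time (a : α) (ls : List (List α)) : (consAll a ls).time = ls.length + 1 := by
  induction ls with
  | nil => rfl
  | cons l ls ih => simp [consAll, time_bind, time_step, ih]

lemma countList_time (l : List α) : (countList l).time = l.length + 1 := by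
  induction l with
  | nil => rfl
  | cons a l ih => simp [countList, time_bind, time_step, ih]

lemma shorter_time (S T : List α) : (shorter S T).time = S.length + T.length + 4 := by
  have hite : ∀ b : Bool, (if b = true then step S else step T).time = 1 := by
    intro b
    split <;> rfl
  simp only [shorter, time_bind, countList_time, time_step, hite]
  omega

lemma allIndices_time (n : ℕ) : (allIndices n).time = n + 1 := rfl

/-- The bound passes through the recursion because `N ^ (m + 1) + N ^ (m + 2)`, the cost of the two
recursive calls, stays below `(N + 1) ^ (m + 2)` with room for the cost of joining their results, which
have length at most `N ^ m`. -/
lemma subsetsOfSize_time_le (m : ℕ) (L : List α) :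
    (subsetsOfSize m L).time ≤ 8 * L.length ^ (m + 1) + 1 := by
  induction L generalizing m with
  | nil => cases m <;> simp [subsetsOfSize, time_step]
  | cons a L ih =>
    cases m with
    | zero => simp [subsetsOfSize, time_step]
    | succ m =>
      simp only [subsetsOfSize, time_bind, consAll_time, consAll_value, appendLists_time,
        List.length_map, length_subsetsOfSize_value, List.length_cons]
      have h1 := ih m
      have h2 := ih (m + 1)
      have h3 : L.length.choose m ≤ L.length ^ m := Nat.choose_le_pow _ _
      have h4 : L.length ^ m ≤ (L.length + 1) ^ m := Nat.pow_le_pow_left (Nat.le_succ _) m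
      have h5 : 1 ≤ (L.length + 1) ^ m := Nat.one_le_pow _ _ (Nat.succ_pos _)
      generalize L.length = N at *
      rw [pow_succ] at h1
      rw [pow_succ, pow_succ] at h2
      have h6 : (N + 1) ^ (m + 1 + 1) = (N + 1) ^ m * (N * N + 2 * N + 1) := by ring
      rw [h6]
      generalize (N + 1) ^ m = b at *
      generalize N ^ m = a at *
      have h7 : a * N ≤ b * N := Nat.mul_le_mul_right N h4
      have h8 : a * N * N ≤ b * N * N := Nat.mul_le_mul_right N h7
      have h9 : b * (N * N + 2 * N + 1) = b * N * N + 2 * (b * N) + b := by ring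
      rw [h9]
      omega

lemma readRow_time {k : ℕ} (v : Fin k → α) : (readRow k v).time = 2 * k + 1 := by
  induction k with
  | zero => rfl
  | succ k ih =>
    simp only [readRow, time_bind, time_step, ih]
    omega

lemma readRows_time {n k : ℕ} (X : Matrix (Fin n) (Fin k) α) (js : List (Fin n)) :
    (readRows X js).time = js.length * (2 * k + 2) + 1 := by
  induction js with
  | nil => simp [readRows, time_step]
  | cons j js ih =>
    simp only [readRows, time_bind, time_step, readRow_time, ih, List.length_cons]
    ring

lemma dropColumn_time (rows : List (List α)) : (dropColumn rows).time = rows.length + 1 := by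
  induction rows with
  | nil => rfl
  | cons v vs ih => simp [dropColumn, time_bind, time_step, ih]

end Lists

section Products

variable {K : Type} [Field K]

lemma subMul_time (c : K) {k : ℕ} (x y : Fin k → K) :
    (subMul c (List.ofFn x) (List.ofFn y)).time = 3 * k + 1 := by
  induction k with
  | zero => simp [subMul, time_step]
  | succ k ih =>
    simp only [List.ofFn_succ, subMul, time_bind, time_step, ih]
    omega

lemma eliminate_time {k : ℕ} (p : Fin (k + 1) → K) (vs : List (Fin (k + 1) → K)) :
    (eliminate (List.ofFn p) (vs.map List.ofFn)).time = vs.length * (3 * k + 3) + 1 := by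
  induction vs with
  | nil => simp [eliminate, time_step]
  | cons v vs ih =>
    simp only [List.map_cons, eliminate, time_bind, time_step, ih, List.length_cons]
    simp only [List.ofFn_succ, List.tail_cons, subMul_time]
    ring

lemma rowMul_time {n k : ℕ} (f : Fin n → K) (X : Matrix (Fin n) (Fin k) K) (js : List (Fin n)) :
    (rowMul f X js).time = js.length * (5 * k + 3) + 2 * k + 1 := by
  induction js with
  | nil => simp [rowMul, readRow_time]
  | cons j js ih =>
    simp only [rowMul, time_bind, time_step, ih, rowMul_value, readRow_time, readRow_value,
      subMul_time, List.length_cons]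
    ring

lemma matMulRows_time {n k r : ℕ} (F : Matrix (Fin r) (Fin n) K) (X : Matrix (Fin n) (Fin k) K)
    (idx : List (Fin n)) (is : List (Fin r)) :
    (matMulRows F X idx is).time =
      is.length * (idx.length * (5 * k + 3) + 2 * k + 2) + 1 := by
  induction is with
  | nil => simp [matMulRows, time_step]
  | cons i is ih =>
    simp only [matMulRows, time_bind, time_step, ih, rowMul_time, List.length_cons]
    ring

lemma matMul_time_le {n k r ρ : ℕ} (F : Matrix (Fin r) (Fin n) K) (X : Matrix (Fin n) (Fin k) K)
    (hn : 1 ≤ n) (hk : 1 ≤ k) (hr : r ≤ ρ * n) :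
    (matMul F X).time ≤ (4 + 13 * ρ) * (n ^ 2 * k) := by
  simp only [matMul, time_bind, allIndices_time, allIndices_value, matMulRows_time,
    List.length_finRange]
  have h1 : n * (5 * k + 3) + 2 * k + 2 ≤ 12 * (n * k) := by nlinarith [Nat.mul_le_mul hn hk]
  have h2 : r * (n * (5 * k + 3) + 2 * k + 2) ≤ (ρ * n) * (12 * (n * k)) := Nat.mul_le_mul hr h1
  have h3 : n ≤ n ^ 2 * k := by nlinarith [Nat.mul_le_mul hn hk]
  have h4 : r ≤ ρ * (n ^ 2 * k) := hr.trans (Nat.mul_le_mul_left ρ h3)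
  have h5 : (ρ * n) * (12 * (n * k)) = 12 * (ρ * (n ^ 2 * k)) := by ring
  have h6 : (4 + 13 * ρ) * (n ^ 2 * k) = 4 * (n ^ 2 * k) + 13 * (ρ * (n ^ 2 * k)) := by ring
  omega

end Products

section Elimination

variable {K : Type} [Field K] [DecidableEq K]

lemma extractPivot_time_le (rows : List (List K)) :
    (extractPivot rows).time ≤ 2 * rows.length + 1 := by
  induction rows with
  | nil => simp [extractPivot, time_step]
  | cons v vs ih =>
    simp only [extractPivot, time_bind, List.length_cons]
    rw [time_step]
    split
    · simp only [time_bind, time_step]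
      omega
    · simp only [time_step]
      omega

/-- Clearing one of the `k` columns of `N` rows costs at most `(3 k + 6) (N + 1)` steps. -/
lemma rankOf_time_le {k : ℕ} (vs : List (Fin k → K)) :
    (rankOf k (vs.map List.ofFn)).time ≤ 1 + k * (3 * k + 6) * (vs.length + 1) := by
  induction k with
  | zero => simp [rankOf, time_step]
  | succ k ih =>
    have h0 := extractPivot_time_le (vs.map List.ofFn)
    rw [List.length_map] at h0
    rcases extractPivot_value vs with ⟨h, -⟩ | ⟨p, ws, h, hperm, -⟩
    · have h1 := ih (vs.map Fin.tail)
      simp only [rankOf, time_bind, h, dropColumn_time, dropColumn_value]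
      simp only [List.length_map] at h1 ⊢
      nlinarith [Nat.zero_le (k * vs.length)]
    · have h1 := ih (ws.map (clearLeading p))
      simp only [rankOf, time_bind, time_step, h, eliminate_time, eliminate_value]
      have hlen := hperm.length_eq
      rw [List.length_cons] at hlen
      rw [List.length_map] at h1
      rw [hlen] at h0 ⊢
      nlinarith [Nat.zero_le (k * ws.length)]

/-- The cost of a rank computation on at most `k` rows with `k` entries. -/
lemma rankOf_time_le_cube {k : ℕ} (hk : 1 ≤ k) (vs : List (Fin k → K)) (h : vs.length ≤ k) :
    (rankOf k (vs.map List.ofFn)).time ≤ 19 * k ^ 3 := by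
  refine (rankOf_time_le vs).trans ?_
  have h1 : 3 * k + 6 ≤ 9 * k := by omega
  have h2 : vs.length + 1 ≤ 2 * k := by omega
  have h3 : k * (3 * k + 6) * (vs.length + 1) ≤ k * (9 * k) * (2 * k) :=
    Nat.mul_le_mul (Nat.mul_le_mul_left k h1) h2
  have h4 : k * (9 * k) * (2 * k) = 18 * k ^ 3 := by ring
  have h5 : 1 ≤ k ^ 3 := Nat.one_le_pow _ _ hk
  omega

variable {n k : ℕ}

lemma splitByRank_time_le (hk : 1 ≤ k) (X : Matrix (Fin n) (Fin k) K) (W : List (Fin n))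
    (hW : W.length + 1 ≤ k) (js : List (Fin n)) :
    (splitByRank X ((W.map X.row).map List.ofFn) js).time ≤ js.length * (24 * k ^ 3) + 1 := by
  induction js with
  | nil => simp [splitByRank, time_step]
  | cons j js ih =>
    have h1 := rankOf_time_le_cube hk (X.row j :: W.map X.row) (by simpa using hW)
    have h1' : (rankOf k (List.ofFn (X j) :: (W.map X.row).map List.ofFn)).time ≤ 19 * k ^ 3 := h1
    have h2 : k ≤ k ^ 3 := Nat.le_self_pow (by norm_num) k
    have hite : ∀ (b : Bool) (x y : List (Fin n) × List (Fin n)),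
        (if b = true then step x else step y).time = 1 := by
      intro b x y
      split <;> rfl
    simp only [splitByRank, time_bind, time_step, readRow_time, readRow_value, hite,
      List.length_cons, Nat.succ_mul js.length]
    omega

/-- Each candidate costs `n + 1` rank computations on at most `k` rows. -/
lemma closeCandidates_time_le (hn : 1 ≤ n) (hk : 1 ≤ k) (X : Matrix (Fin n) (Fin k) K)
    (Ws : List (List (Fin n))) (hWs : ∀ W ∈ Ws, W.length + 1 ≤ k) :
    (closeCandidates X (List.finRange n) Ws).time ≤ Ws.length * (51 * (n * k ^ 3)) + 1 := by
  induction Ws with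
  | nil => simp [closeCandidates, time_step]
  | cons W Ws ih =>
    have hW := hWs W List.mem_cons_self
    have h1 := rankOf_time_le_cube hk (W.map X.row) (by simpa using (Nat.le_succ _).trans hW)
    have h2 := splitByRank_time_le hk X W hW (List.finRange n)
    have h3 := ih fun W hW => hWs W (List.mem_cons_of_mem _ hW)
    have h4 : W.length * (2 * k + 2) ≤ 4 * k ^ 3 := by
      have h41 : W.length * (2 * k + 2) ≤ k * (4 * k) := Nat.mul_le_mul (by omega) (by omega)
      have h42 : k * (4 * k) = 4 * k ^ 2 := by ring
      have h43 : k ^ 2 ≤ k ^ 3 := Nat.pow_le_pow_right hk (by norm_num)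
      omega
    have h5 : 1 ≤ k ^ 3 := Nat.one_le_pow _ _ hk
    have h6 : k ^ 3 ≤ n * k ^ 3 := Nat.le_mul_of_pos_left _ hn
    have h7 : n * (24 * k ^ 3) = 24 * (n * k ^ 3) := by ring
    rw [List.length_finRange, h7] at h2
    simp only [closeCandidates, time_bind, readRows_time, readRows_value, List.length_cons,
      Nat.succ_mul Ws.length]
    rw [time_step]
    split
    · simp only [time_bind, time_step]
      omega
    · simp only [time_step]
      omega

lemma closeCandidates_length_le (X : Matrix (Fin n) (Fin k) K) (idx : List (Fin n))
    (Ws : List (List (Fin n))) : (closeCandidates X idx Ws).value.length ≤ Ws.length := by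
  induction Ws with
  | nil => simp [closeCandidates]
  | cons W Ws ih =>
    simp only [closeCandidates, value_bind]
    split
    · simpa using ih
    · simpa using ih.trans (Nat.le_succ _)

lemma enumerateMinimalSets_length_le (X : Matrix (Fin n) (Fin k) K) :
    (enumerateMinimalSets X).value.length ≤ n ^ (k - 1) := by
  refine (closeCandidates_length_le _ _ _).trans ?_
  rw [length_subsetsOfSize_value, allIndices_value, List.length_finRange]
  exact Nat.choose_le_pow _ _

lemma enumerateMinimalSets_time_le (hn : 1 ≤ n) (hk : 1 ≤ k) (X : Matrix (Fin n) (Fin k) K) :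
    (enumerateMinimalSets X).time ≤ 63 * (n ^ k * k ^ 3) := by
  simp only [enumerateMinimalSets, time_bind, allIndices_time, allIndices_value]
  have h1 := subsetsOfSize_time_le (k - 1) (List.finRange n)
  rw [List.length_finRange, Nat.sub_add_cancel hk] at h1
  have h2 := closeCandidates_time_le hn hk X (subsetsOfSize (k - 1) (List.finRange n)).value
    fun W hW => by
      have := ((mem_subsetsOfSize_value _ _ _).mp hW).2
      omega
  rw [length_subsetsOfSize_value, List.length_finRange] at h2
  have h3 : n.choose (k - 1) * (51 * (n * k ^ 3)) ≤ 51 * (n ^ k * k ^ 3) := by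
    calc n.choose (k - 1) * (51 * (n * k ^ 3)) ≤ n ^ (k - 1) * (51 * (n * k ^ 3)) :=
          Nat.mul_le_mul_right _ (Nat.choose_le_pow _ _)
      _ = 51 * (n ^ (k - 1) * n * k ^ 3) := by ring
      _ = 51 * (n ^ k * k ^ 3) := by rw [← pow_succ, Nat.sub_add_cancel hk]
  have h4 : n ≤ n ^ k := Nat.le_self_pow (by omega) n
  have h5 : n ^ k ≤ n ^ k * k ^ 3 := Nat.le_mul_of_pos_right _ (Nat.one_le_pow _ _ hk)
  omega

/-- The test eliminates on at most `n + r ≤ (1 + ρ) n` rows with `k` entries. -/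
lemma fullRankCheck_time_le {r ρ : ℕ} (hn : 1 ≤ n) (hk : 1 ≤ k) (hr : r ≤ ρ * n)
    (F : Matrix (Fin r) (Fin n) K) (X : Matrix (Fin n) (Fin k) K) (W' : List (Fin n))
    (hW' : W'.length ≤ n) :
    (fullRankCheck X (matMul F X).value W').time ≤ (27 + 9 * ρ) * (n * k ^ 2) := by
  have h0 := rankOf_time_le (W'.map X.row ++ (List.finRange r).map (F * X).row)
  rw [List.map_append] at h0
  simp only [fullRankCheck, time_bind, time_step, readRows_time, readRows_value, appendLists_time,
    appendLists_value, matMul_value]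
  simp only [List.length_append, List.length_map, List.length_finRange] at h0 ⊢
  have h1 : k * (3 * k + 6) * (W'.length + r + 1) ≤ k * (9 * k) * (n + ρ * n + n) :=
    Nat.mul_le_mul (Nat.mul_le_mul_left k (by omega)) (by omega)
  have h2 : k * (9 * k) * (n + ρ * n + n) = 18 * (n * k ^ 2) + 9 * (ρ * (n * k ^ 2)) := by ring
  have h3 : W'.length * (2 * k + 2) ≤ n * (4 * k) := Nat.mul_le_mul hW' (by omega)
  have h4 : n * (4 * k) = 4 * (n * k) := by ring
  have h5 : n * k ≤ n * k ^ 2 := Nat.mul_le_mul_left n (Nat.le_self_pow (by norm_num) k)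
  have h6 : n ≤ n * k := Nat.le_mul_of_pos_right n hk
  have h7 : (27 + 9 * ρ) * (n * k ^ 2) = 27 * (n * k ^ 2) + 9 * (ρ * (n * k ^ 2)) := by ring
  omega

lemma smallestPassing_time_le {r ρ : ℕ} (hn : 1 ≤ n) (hk : 1 ≤ k) (hr : r ≤ ρ * n)
    (F : Matrix (Fin r) (Fin n) K) (X : Matrix (Fin n) (Fin k) K)
    (es : List (List (Fin n) × List (Fin n))) (hes : ∀ e ∈ es, e.1.length ≤ n ∧ e.2.length ≤ n) :
    (smallestPassing X (matMul F X).value (List.finRange n) es).time ≤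
      es.length * ((34 + 9 * ρ) * (n * k ^ 2)) + 1 := by
  induction es with
  | nil => simp [smallestPassing, time_step]
  | cons e es ih =>
    obtain ⟨he1, he2⟩ := hes e List.mem_cons_self
    have h1 := ih fun e he => hes e (List.mem_cons_of_mem _ he)
    have h2 := fullRankCheck_time_le hn hk hr F X e.1 he1
    have h3 := (smallestPassing_spec X (matMul F X).value (List.finRange n) es).2.1
    rw [List.length_finRange] at h3
    simp only [smallestPassing, time_bind, time_step, value_step, shorter_time, List.length_cons,
      Nat.succ_mul es.length]
    have h4 : (if (fullRankCheck X (matMul F X).value e.1).value = true then e.2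
        else List.finRange n).length ≤ n := by
      split
      · exact he2
      · exact List.length_finRange.le
    have h5 : n ≤ n * k ^ 2 := Nat.le_mul_of_pos_right n (Nat.one_le_pow _ _ hk)
    have h6 : (34 + 9 * ρ) * (n * k ^ 2) = (27 + 9 * ρ) * (n * k ^ 2) + 7 * (n * k ^ 2) := by ring
    omega

lemma enumerated_length_le {X : Matrix (Fin n) (Fin k) K} {e : List (Fin n) × List (Fin n)}
    (he : e ∈ (enumerateMinimalSets X).value) : e.1.length ≤ n ∧ e.2.length ≤ n := by
  obtain ⟨h1, h2, -⟩ := enumerated_spec he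
  exact ⟨by simpa using h1.length_le, by simpa using h2.length_le⟩

lemma smallestOverEigenvalues_time_le {r ρ kc : ℕ} (hn : 1 ≤ n) (hr : r ≤ ρ * n)
    (F : Matrix (Fin r) (Fin n) K) (Xs : List ((k : ℕ) × Matrix (Fin n) (Fin k) K))
    (hXs : ∀ X ∈ Xs, 1 ≤ X.1 ∧ X.1 ≤ kc) :
    (smallestOverEigenvalues F (List.finRange n) Xs).time ≤
      Xs.length * ((108 + 22 * ρ) * (n ^ (kc + 1) * kc ^ 3)) + 1 := by
  induction Xs with
  | nil => simp [smallestOverEigenvalues, time_step]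
  | cons X Xs ih =>
    obtain ⟨hk, hkc⟩ := hXs X List.mem_cons_self
    have h1 := ih fun X hX => hXs X (List.mem_cons_of_mem _ hX)
    have h2 := enumerateMinimalSets_time_le hn hk X.2
    have h3 := matMul_time_le F X.2 hn hk hr
    have h4 := smallestPassing_time_le hn hk hr F X.2 (enumerateMinimalSets X.2).value
      fun e he => enumerated_length_le he
    have h5 := (smallestPassing_spec X.2 (matMul F X.2).value (List.finRange n)
      (enumerateMinimalSets X.2).value).2.1
    have h6 := (smallestOverEigenvalues_spec F (List.finRange n) Xs).2.1
    rw [List.length_finRange] at h5 h6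
    simp only [smallestOverEigenvalues, time_bind, shorter_time, List.length_cons,
      Nat.succ_mul Xs.length]
    set P := n ^ (kc + 1) * kc ^ 3 with hP
    have hcube : X.1 ^ 3 ≤ kc ^ 3 := Nat.pow_le_pow_left hkc 3
    have hkc1 : 1 ≤ kc := hk.trans hkc
    have h7 : n ^ X.1 * X.1 ^ 3 ≤ P :=
      Nat.mul_le_mul (Nat.pow_le_pow_right hn (by omega)) hcube
    have h8 : n ^ 2 * X.1 ≤ P :=
      Nat.mul_le_mul (Nat.pow_le_pow_right hn (by omega))
        ((Nat.le_self_pow (by norm_num) _).trans hcube)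
    have h9 : n ≤ P := by
      calc n ≤ n ^ (kc + 1) := Nat.le_self_pow (by omega) n
        _ ≤ P := Nat.le_mul_of_pos_right _ (Nat.one_le_pow _ _ hkc1)
    have h10 : (enumerateMinimalSets X.2).value.length * ((34 + 9 * ρ) * (n * X.1 ^ 2)) ≤
        (34 + 9 * ρ) * P := by
      calc (enumerateMinimalSets X.2).value.length * ((34 + 9 * ρ) * (n * X.1 ^ 2))
          ≤ n ^ (X.1 - 1) * ((34 + 9 * ρ) * (n * X.1 ^ 2)) :=
            Nat.mul_le_mul_right _ (enumerateMinimalSets_length_le X.2)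
        _ = (34 + 9 * ρ) * (n ^ (X.1 - 1) * n * X.1 ^ 2) := by ring
        _ = (34 + 9 * ρ) * (n ^ X.1 * X.1 ^ 2) := by rw [← pow_succ, Nat.sub_add_cancel hk]
        _ ≤ (34 + 9 * ρ) * P := by
            refine Nat.mul_le_mul_left _ (le_trans ?_ h7)
            exact Nat.mul_le_mul_left _ (Nat.pow_le_pow_right hk (by norm_num))
    have h11 : (4 + 13 * ρ) * (n ^ 2 * X.1) ≤ (4 + 13 * ρ) * P := Nat.mul_le_mul_left _ h8
    have h12 : (4 + 13 * ρ) * P = 4 * P + 13 * (ρ * P) := by ring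
    have h13 : (34 + 9 * ρ) * P = 34 * P + 9 * (ρ * P) := by ring
    have h14 : (108 + 22 * ρ) * P = 108 * P + 22 * (ρ * P) := by ring
    omega

lemma minimumBlockingSet_time_le {r ρ kc c₀ : ℕ} (hn : 1 ≤ n) (hkc : 1 ≤ kc) (hr : r ≤ ρ * n)
    (F : Matrix (Fin r) (Fin n) K) (Xs : List ((k : ℕ) × Matrix (Fin n) (Fin k) K))
    (hXs : ∀ X ∈ Xs, 1 ≤ X.1 ∧ X.1 ≤ kc) (hlen : Xs.length ≤ n) :
    (minimumBlockingSet c₀ F Xs).time ≤ (c₀ + 111 + 22 * ρ) * (n ^ (kc + 2) * kc ^ 3) := by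
  have h1 := smallestOverEigenvalues_time_le hn hr F Xs hXs
  have htime : (minimumBlockingSet c₀ F Xs).time =
      c₀ * n ^ 3 + (n + 1 + (smallestOverEigenvalues F (List.finRange n) Xs).time) := rfl
  rw [htime]
  set P := n ^ (kc + 2) * kc ^ 3 with hP
  have hkc3 : 1 ≤ kc ^ 3 := Nat.one_le_pow _ _ hkc
  have h2 : Xs.length * ((108 + 22 * ρ) * (n ^ (kc + 1) * kc ^ 3)) ≤ (108 + 22 * ρ) * P := by
    calc Xs.length * ((108 + 22 * ρ) * (n ^ (kc + 1) * kc ^ 3))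
        ≤ n * ((108 + 22 * ρ) * (n ^ (kc + 1) * kc ^ 3)) := Nat.mul_le_mul_right _ hlen
      _ = (108 + 22 * ρ) * P := by rw [hP]; ring
  have h3 : n ^ 3 ≤ P := (Nat.pow_le_pow_right hn (by omega)).trans (Nat.le_mul_of_pos_right _ hkc3)
  have h4 : n ≤ P := (Nat.le_self_pow (by omega) n).trans (Nat.le_mul_of_pos_right _ hkc3)
  have h5 : c₀ * n ^ 3 ≤ c₀ * P := Nat.mul_le_mul_left _ h3
  have h6 : (c₀ + 111 + 22 * ρ) * P = c₀ * P + 111 * P + 22 * (ρ * P) := by ring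
  have h7 : (108 + 22 * ρ) * P = 108 * P + 22 * (ρ * P) := by ring
  omega

end Elimination

/-! ### Optimality -/

section Optimality

variable {n r : ℕ} {A : Matrix (Fin n) (Fin n) ℝ} (E : EigenData A)

lemma EigenData.hasEigenvalue (i : Fin E.q) :
    Module.End.HasEigenvalue (Matrix.toLin' (complexify A)) (E.eigenvalue i) :=
  (E.eigenvalue_complete _).mpr ⟨i, rfl⟩

lemma EigenData.one_le_mult (i : Fin E.q) : 1 ≤ E.mult i := by
  by_contra h
  have h0 : E.mult i = 0 := by omega
  obtain ⟨x, hx, hx0⟩ := (E.hasEigenvalue i).exists_hasEigenvector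
  obtain ⟨c, rfl⟩ := (E.mem_eigenspace_iff i x).mp hx
  have : IsEmpty (Fin (E.mult i)) := by rw [h0]; infer_instance
  exact hx0 (by rw [Subsingleton.elim c 0, Matrix.mulVec_zero])

/-- Eigenvectors for distinct eigenvalues are linearly independent. -/
lemma EigenData.q_le : E.q ≤ n := by
  choose x hx using fun i => (E.hasEigenvalue i).exists_hasEigenvector
  have h := (Module.End.eigenvectors_linearIndependent' _ E.eigenvalue E.eigenvalue_injective x
    hx).fintype_card_le_finrank
  simpa using h

lemma EigenData.mem_basisList {X : (k : ℕ) × Matrix (Fin n) (Fin k) ℂ} :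
    X ∈ E.basisList ↔ ∃ i, ⟨E.mult i, E.basis i⟩ = X := by
  rw [EigenData.basisList, List.mem_ofFn]

lemma EigenData.hidesMode_iff (F : Matrix (Fin r) (Fin n) ℝ) (S : Finset (Fin n)) :
    HidesMode A F S ↔ ∃ i, ∃ c ∈ hiddenCoeffs (E.basis i) S,
      (complexify F * E.basis i).mulVec c ≠ 0 := by
  constructor
  · rintro ⟨μ, v, hv, hS, hF⟩
    have hv0 : v ≠ 0 := by
      rintro rfl
      exact hF (Matrix.mulVec_zero _)
    have hmem : v ∈ Module.End.eigenspace (Matrix.toLin' (complexify A)) μ :=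
      Module.End.mem_eigenspace_iff.mpr hv
    obtain ⟨i, rfl⟩ := (E.eigenvalue_complete μ).mp
      (Module.End.hasEigenvalue_of_hasEigenvector ⟨hmem, hv0⟩)
    obtain ⟨c, rfl⟩ := (E.mem_eigenspace_iff i v).mp hmem
    exact ⟨i, c, mem_hiddenCoeffs.mpr hS, by rwa [← Matrix.mulVec_mulVec]⟩
  · rintro ⟨i, c, hc, hF⟩
    exact ⟨E.eigenvalue i, (E.basis i).mulVec c,
      Module.End.mem_eigenspace_iff.mp ((E.mem_eigenspace_iff i _).mpr ⟨c, rfl⟩),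
      mem_hiddenCoeffs.mp hc, by rwa [Matrix.mulVec_mulVec]⟩

/-- Blocking all states hides a mode seen by a nonzero `F`. -/
lemma hidesMode_univ (hA : IsDiagonalizable A) {F : Matrix (Fin r) (Fin n) ℝ} (hF : F ≠ 0) :
    HidesMode A F Finset.univ := by
  have hx : ∃ x, F.mulVec x ≠ 0 := by
    by_contra! h
    exact hF (Matrix.ext_of_mulVec_single fun j => by rw [h, Matrix.zero_mulVec])
  obtain ⟨x, hx⟩ := hx
  exact hidesMode_of_pow_mulVec hA (fun k j hj => absurd (Finset.mem_univ j) hj) hx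

lemma EigenData.fullRankCheck_iff (F : Matrix (Fin r) (Fin n) ℝ) (i : Fin E.q)
    {e : List (Fin n) × List (Fin n)} (he : e ∈ (enumerateMinimalSets (E.basis i)).value) :
    (fullRankCheck (E.basis i) (matMul (complexify F) (E.basis i)).value e.1).value = true ↔
      ∀ c ∈ hiddenCoeffs (E.basis i) e.2.toFinset,
        (complexify F * E.basis i).mulVec c = 0 → c = 0 :=
  FunctionalPrivacy.fullRankCheck_iff _ _ fun j => by
    rw [List.mem_toFinset]
    exact (enumerated_spec he).2.2 j

/-- The algorithm returns a smallest set that hides a mode seen by `F`. -/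
lemma EigenData.isMinimumSet_hidesMode (hA : IsDiagonalizable A) {F : Matrix (Fin r) (Fin n) ℝ}
    (hF : F ≠ 0) (c₀ : ℕ) :
    IsMinimumSet (HidesMode A F)
      (minimumBlockingSet c₀ (complexify F) E.basisList).value.toFinset := by
  have hval : (minimumBlockingSet c₀ (complexify F) E.basisList).value =
      (smallestOverEigenvalues (complexify F) (List.finRange n) E.basisList).value := rfl
  rw [hval]
  obtain ⟨h1, -, h3⟩ :=
    smallestOverEigenvalues_spec (complexify F) (List.finRange n) E.basisList
  generalize (smallestOverEigenvalues (complexify F) (List.finRange n) E.basisList).value = R at *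
  constructor
  · rcases h1 with rfl | ⟨X, hX, e, he, hok, rfl⟩
    · rw [List.toFinset_finRange]
      exact hidesMode_univ hA hF
    · obtain ⟨i, rfl⟩ := E.mem_basisList.mp hX
      rw [E.fullRankCheck_iff F i he] at hok
      have hone := ((enumerated_iff_minimal _ _).mp ⟨e, he, rfl⟩).prop
      obtain ⟨c, hc, hc0⟩ := (Submodule.ne_bot_iff _).mp
        (Submodule.one_le_finrank_iff.mp hone.ge)
      exact (E.hidesMode_iff F _).mpr ⟨i, c, hc, fun h => hc0 (hok c hc h)⟩
  · intro T hT
    obtain ⟨i, hc⟩ := (E.hidesMode_iff F T).mp hT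
    obtain ⟨S, hST, hmin, hinj⟩ := exists_minimal_hidden (E.eq_zero_of_mulVec_eq_zero i) _ hc
    obtain ⟨e, he, rfl⟩ := (enumerated_iff_minimal _ _).mpr hmin
    have hle := h3 _ (E.mem_basisList.mpr ⟨i, rfl⟩) e he ((E.fullRankCheck_iff F i he).mpr hinj)
    have hnodup : e.2.Nodup := (List.nodup_finRange n).sublist (enumerated_spec he).2.1
    calc R.toFinset.card ≤ R.length := R.toFinset_card_le
      _ ≤ e.2.length := hle
      _ = e.2.toFinset.card := (List.toFinset_card_of_nodup hnodup).symm
      _ ≤ T.card := Finset.card_le_card hST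

end Optimality

end FunctionalPrivacy

theorem mainTheorem2 (c₀ ρ : ℕ) :
    ∃ c : ℕ, ∀ (n m r kc : ℕ)
      (A : Matrix (Fin n) (Fin n) ℝ) (B : Matrix (Fin n) (Fin m) ℝ)
      (F : Matrix (Fin r) (Fin n) ℝ) (E : FunctionalPrivacy.EigenData A),
      F ≠ 0 → r ≤ ρ * n →
      FunctionalPrivacy.IsDiagonalizable A →
      (∀ i, E.mult i ≤ kc) →
      -- the output is an optimal solution of the blocking problem, in both of its forms
      FunctionalPrivacy.IsMinimumSet (FunctionalPrivacy.BlocksEveryOutput A B F)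
        (FunctionalPrivacy.minimumBlockingSet c₀ (FunctionalPrivacy.complexify F)
          E.basisList).value.toFinset ∧
      FunctionalPrivacy.IsMinimumSet (FunctionalPrivacy.BlocksDedicated A B F)
        (FunctionalPrivacy.minimumBlockingSet c₀ (FunctionalPrivacy.complexify F)
          E.basisList).value.toFinset ∧
      -- the enumeration returns exactly the minimal sets that drop the rank to `n - 1`
      (∀ (i : Fin E.q) (S : Finset (Fin n)),
        (∃ e ∈ (FunctionalPrivacy.enumerateMinimalSets (E.basis i)).value, e.2.toFinset = S) ↔
          Minimal (fun T => (FunctionalPrivacy.sensorPencil A (E.eigenvalue i) T).rank + 1 = n)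
            S) ∧
      -- the check accepts exactly those of them that have full rank once `F` is appended
      (∀ (i : Fin E.q), ∀ e ∈ (FunctionalPrivacy.enumerateMinimalSets (E.basis i)).value,
        ((FunctionalPrivacy.fullRankCheck (E.basis i)
            (FunctionalPrivacy.matMul (FunctionalPrivacy.complexify F) (E.basis i)).value
            e.1).value = true ↔
          (FunctionalPrivacy.sensorPencilWith A F (E.eigenvalue i) e.2.toFinset).rank = n)) ∧
      -- the running time
      (FunctionalPrivacy.minimumBlockingSet c₀ (FunctionalPrivacy.complexify F) E.basisList).time ≤
        c * (n ^ (kc + 2) * kc ^ 3) := by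
  refine ⟨c₀ + 111 + 22 * ρ, fun n m r kc A B F E hF hr hA hkc => ?_⟩
  have hopt := E.isMinimumSet_hidesMode hA hF c₀
  refine ⟨?_, ?_, fun i S => ?_, fun i e he => ?_, ?_⟩
  · rwa [funext fun S => propext (FunctionalPrivacy.blocksEveryOutput_iff hA B F S)]
  · rwa [funext fun S => propext (FunctionalPrivacy.blocksDedicated_iff hA B F S)]
  · simp only [E.rank_sensorPencil_add_one]
    exact FunctionalPrivacy.enumerated_iff_minimal _ _
  · rw [E.fullRankCheck_iff F i he, E.rank_sensorPencilWith]
  · -- since `F ≠ 0`, there is at least one state and at least one eigenvalue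
    obtain ⟨i, -⟩ :=
      (E.hidesMode_iff F Finset.univ).mp (FunctionalPrivacy.hidesMode_univ hA hF)
    have hn : 1 ≤ n := (Nat.one_le_of_lt i.2).trans E.q_le
    refine FunctionalPrivacy.minimumBlockingSet_time_le hn ((E.one_le_mult i).trans (hkc i)) hr _ _
      (fun X hX => ?_) ?_
    · obtain ⟨i, rfl⟩ := E.mem_basisList.mp hX
      exact ⟨E.one_le_mult i, hkc i⟩
    · rw [FunctionalPrivacy.EigenData.basisList, List.length_ofFn]
      exact E.q_le
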